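/- Let $\Gamma$ be a discrete group acting by measure preserving transformations on a probability space $(X,\mu)$, let $\pi\colon\Gamma\to O(H)$ be an orthogonal representation on a real Hilbert space $H$ and let $b\colon\Gamma\to H$ be a 1-cocycle, i.e. $b(gh)=\pi(g)b(h)+b(g)$ for all $g,h\in\Gamma$. Put $A=L^\infty(X,\mu)$ with the action $(\sigma_g a)(x)=a(g^{-1}x)$. Fix an orthonormal basis $(e_n)_{n\in I}$ of $H$, let $(Z,\nu)=\prod_{n\in I}\bigl(\mathbb R,\tfrac1{\sqrt{2\pi}}e^{-x^2/2}dx\bigr)$, and let $\omega\colon H\to\mathcal U(L^\infty(Z,\nu))$ be the continuous extension of the map $\omega(\sum_n c_ne_n)(z)=\exp(\sqrt2\, i\sum_n c_nz_n)$ defined on finite linear combinations. Let $D=\{\omega(\xi)\mid\xi\in H\}''\subseteq L^\infty(Z,\nu)$ with the Gaussian action $\sigma_g(\omega(\xi))=\omega(\pi(g)\xi)$, and let $\tilde M=(D\bar\otimes A)\rtimes\Gamma$ be the crossed product by the diagonal action, with canonical unitaries $u_g$, trace $\tau(\sum_g x_gu_g)=\int x_e\,d(\nu\times\mu)$ and 2-norm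 $\|x\|_2=\tau(x^*x)^{1/2}$. Let $M=A\rtimes\Gamma$, identified with the von Neumann subalgebra $(1\otimes A)\rtimes\Gamma$ of $\tilde M$, and let $E_M\colon\tilde M\to M$ be the $\tau$-preserving conditional expectation. For $t\in\mathbb R$ let $\alpha_t$ be the automorphism of $\tilde M$ with $\alpha_t=\mathrm{id}$ on $D\bar\otimes A$ and $\alpha_t(u_g)=(\omega(tb(g))\otimes1)u_g$ for $g\in\Gamma$. Let $Q\subseteq M$ be a (unital) von Neumann subalgebra, let $\delta>0$ and $t\in\mathbb R$, and suppose that $\|E_M(\alpha_t(x))\|_2\ge\delta$ for every unitary $x\in Q$. Then there is a non-zero partial isometry $v\in\tilde M$ such that $\alpha_t(x)v=vx$ for all $x\in Q$. -/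

import Mathlib

open MeasureTheory ProbabilityTheory
open scoped ENNReal InnerProductSpace

noncomputable section

namespace GaussianDeformation

/-! ### Von Neumann algebras generated by a set of operators -/

section Generated

variable {K : Type*} [NormedAddCommGroup K] [InnerProductSpace ℂ K] [CompleteSpace K]

/-- The commutant of `S ∪ S*`, as a von Neumann algebra. -/
def commutantOf (S : Set (K →L[ℂ] K)) : VonNeumannAlgebra K where
  toStarSubalgebra := StarSubalgebra.centralizer ℂ S
  centralizer_centralizer' := by simp

/-- The von Neumann algebra `(S ∪ S*)''` generated by a set `S` of bounded operators. -/
def vnGenerated (S : Set (K →L[ℂ] K)) : VonNeumannAlgebra K :=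
  (commutantOf S).commutant

theorem mem_commutantOf {S : Set (K →L[ℂ] K)} {z : K →L[ℂ] K} :
    z ∈ commutantOf S ↔ ∀ s ∈ S, s * z = z * s ∧ star s * z = z * star s :=
  StarSubalgebra.mem_centralizer_iff ℂ

theorem mem_vnGenerated {S : Set (K →L[ℂ] K)} {x : K →L[ℂ] K} :
    x ∈ vnGenerated S ↔ ∀ z ∈ commutantOf S, z * x = x * z :=
  VonNeumannAlgebra.mem_commutant_iff

theorem subset_vnGenerated (S : Set (K →L[ℂ] K)) {x : K →L[ℂ] K} (hx : x ∈ S) :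
    x ∈ vnGenerated S := by
  rw [mem_vnGenerated]
  intro z hz
  exact ((mem_commutantOf.1 hz x hx).1).symm

/-- `vnGenerated S` is the smallest von Neumann algebra containing `S`. -/
theorem vnGenerated_le {S : Set (K →L[ℂ] K)} {N : VonNeumannAlgebra K}
    (h : ∀ s ∈ S, s ∈ N) : vnGenerated S ≤ N := by
  intro x hx
  rw [← VonNeumannAlgebra.commutant_commutant N, VonNeumannAlgebra.mem_commutant_iff]
  intro z hz
  rw [VonNeumannAlgebra.mem_commutant_iff] at hz
  exact mem_vnGenerated.1 hx z
    (mem_commutantOf.2 fun s hs => ⟨hz s (h s hs), hz _ (star_mem (h s hs))⟩)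

end Generated

/-! ### Multiplication operators -/

section Multiplication

variable {Y : Type*} [MeasurableSpace Y] {m : Measure Y}

/-- The operator of multiplication by `φ ∈ L^∞` on `L²`. -/
def mulOp (φ : Lp ℂ ∞ m) : Lp ℂ 2 m →L[ℂ] Lp ℂ 2 m :=
  (ContinuousLinearMap.mul ℂ ℂ).holderL m ∞ 2 2 φ

theorem coeFn_mulOp (φ : Lp ℂ ∞ m) (f : Lp ℂ 2 m) :
    mulOp φ f =ᵐ[m] fun y => φ y * f y :=
  (ContinuousLinearMap.mul ℂ ℂ).coeFn_holder φ f

theorem norm_mulOp_le (φ : Lp ℂ ∞ m) : ‖mulOp φ‖ ≤ ‖φ‖ := by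
  refine ContinuousLinearMap.opNorm_le_bound _ (norm_nonneg _) fun f => ?_
  refine ((ContinuousLinearMap.mul ℂ ℂ).norm_holder_apply_apply_le φ f).trans ?_
  have h := ContinuousLinearMap.opNorm_mul_le ℂ ℂ
  have : ‖ContinuousLinearMap.mul ℂ ℂ‖ * (‖φ‖ * ‖f‖) ≤ 1 * (‖φ‖ * ‖f‖) := by gcongr
  linarith

theorem mulOp_comp_of_ae {φ ψ χ : Lp ℂ ∞ m} (h : χ =ᵐ[m] fun y => φ y * ψ y) (f : Lp ℂ 2 m) :
    mulOp φ (mulOp ψ f) = mulOp χ f := by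
  refine Lp.ext ?_
  filter_upwards [coeFn_mulOp φ (mulOp ψ f), coeFn_mulOp ψ f, coeFn_mulOp χ f, h]
    with y h1 h2 h3 h4
  rw [h1, h2, h3, h4, mul_assoc]

theorem mulOp_comm (φ ψ : Lp ℂ ∞ m) (f : Lp ℂ 2 m) :
    mulOp φ (mulOp ψ f) = mulOp ψ (mulOp φ f) := by
  refine Lp.ext ?_
  filter_upwards [coeFn_mulOp φ (mulOp ψ f), coeFn_mulOp ψ f, coeFn_mulOp ψ (mulOp φ f),
    coeFn_mulOp φ f] with y h1 h2 h3 h4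
  rw [h1, h2, h3, h4]
  ring

theorem mulOp_eq_self {φ : Lp ℂ ∞ m} (h : φ =ᵐ[m] fun _ => 1) (f : Lp ℂ 2 m) :
    mulOp φ f = f := by
  refine Lp.ext ?_
  filter_upwards [coeFn_mulOp φ f, h] with y h1 h2
  rw [h1, h2, one_mul]

theorem inner_mulOp_of_ae {φ ψ : Lp ℂ ∞ m} (h : ψ =ᵐ[m] fun y => starRingEnd ℂ (φ y))
    (f g : Lp ℂ 2 m) : ⟪mulOp φ f, g⟫_ℂ = ⟪f, mulOp ψ g⟫_ℂ := by
  rw [L2.inner_def, L2.inner_def]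
  refine integral_congr_ae ?_
  filter_upwards [coeFn_mulOp φ f, coeFn_mulOp ψ g, h] with y h1 h2 h3
  rw [h1, h2, h3]
  simp [RCLike.inner_apply]
  ring

end Multiplication

/-! ### The Gaussian space and the exponentials `ω(ξ)` -/

section Gaussian

variable {ι : Type*}

/-- The product `(Z, ν)` of copies of `(ℝ, (2π)^{-1/2} exp(-x²/2) dx)` indexed by `ι`. -/
def gaussianProduct (ι : Type*) : Measure (ι → ℝ) :=
  Measure.infinitePi fun _ : ι => gaussianReal 0 1

instance : IsProbabilityMeasure (gaussianProduct ι) := by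
  unfold gaussianProduct; infer_instance

theorem memLp_coordinate (i : ι) : MemLp (fun z : ι → ℝ => z i) 2 (gaussianProduct ι) :=
  (memLp_id_gaussianReal' 2 (by simp)).comp_measurePreserving
    (measurePreserving_eval_infinitePi (fun _ : ι => gaussianReal 0 1) i)

/-- The coordinate function `z ↦ z i` in the real space `L²(Z, ν)`. -/
def coordinate (i : ι) : Lp ℝ 2 (gaussianProduct ι) := (memLp_coordinate i).toLp

theorem orthonormal_coordinate :
    Orthonormal ℝ (coordinate : ι → Lp ℝ 2 (gaussianProduct ι)) := by
  classical
  have hin : ∀ i j : ι, ⟪coordinate i, coordinate j⟫_ℝ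
      = ∫ z, z i * z j ∂gaussianProduct ι := by
    intro i j
    rw [L2.inner_def]
    refine integral_congr_ae ?_
    filter_upwards [(memLp_coordinate i).coeFn_toLp, (memLp_coordinate j).coeFn_toLp] with z h1 h2
    simp only [coordinate, h1, h2]
    simp [mul_comm]
  have hmp := fun i : ι => measurePreserving_eval_infinitePi (fun _ : ι => gaussianReal 0 1) i
  rw [orthonormal_iff_ite]
  intro i j
  rw [hin]
  split_ifs with hij
  · subst hij
    have h1 : ∫ z, z i * z i ∂gaussianProduct ι = ∫ x, x ^ 2 ∂gaussianReal 0 1 := by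
      have h := (hmp i).map_eq
      rw [← h, integral_map (measurable_pi_apply i).aemeasurable (by fun_prop)]
      simp [gaussianProduct, sq]
    have h2 := variance_id_gaussianReal (μ := 0) (v := 1)
    rw [variance_of_integral_eq_zero (by fun_prop) (by simp)] at h2
    rw [h1]
    simpa using h2
  · have hind : IndepFun (fun z : ι → ℝ => z i) (fun z : ι → ℝ => z j) (gaussianProduct ι) :=
      (iIndepFun_infinitePi (P := fun _ : ι => gaussianReal 0 1) (X := fun _ x => x)
        (by fun_prop)).indepFun hij
    have h3 : ∫ z, z i ∂gaussianProduct ι = 0 := by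
      have h := (hmp i).map_eq
      have h4 := integral_id_gaussianReal (μ := 0) (v := 1)
      rw [← h, integral_map (measurable_pi_apply i).aemeasurable (by fun_prop)] at h4
      simpa [gaussianProduct, Function.eval] using h4
    have h5 := hind.integral_fun_mul_eq_mul_integral
      (measurable_pi_apply i).aestronglyMeasurable (measurable_pi_apply j).aestronglyMeasurable
    rw [h5, h3, zero_mul]

variable {H : Type*} [NormedAddCommGroup H] [InnerProductSpace ℝ H]

/-- The isometric embedding `H → L²(Z, ν)` with `∑ cₙ eₙ ↦ (z ↦ ∑ cₙ zₙ)`. -/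
def gaussianField (e : HilbertBasis ι ℝ H) : H →ₗᵢ[ℝ] Lp ℝ 2 (gaussianProduct ι) :=
  (orthonormal_coordinate (ι := ι)).orthogonalFamily.linearIsometry.comp
    e.repr.toLinearIsometry

theorem gaussianField_basis (e : HilbertBasis ι ℝ H) (i : ι) :
    gaussianField e (e i) = coordinate i := by
  classical
  simp [gaussianField, e.repr_self, OrthogonalFamily.linearIsometry_apply_single]

/-- The function `exp(√2 i ∑ cₙ zₙ)` associated with the vector `ξ = ∑ cₙ eₙ`. -/
def omegaFun (e : HilbertBasis ι ℝ H) (ξ : H) (z : ι → ℝ) : ℂ :=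
  Complex.exp (((√2 * gaussianField e ξ z : ℝ) : ℂ) * Complex.I)

theorem memLp_omegaFun (e : HilbertBasis ι ℝ H) (ξ : H) :
    MemLp (omegaFun e ξ) ∞ (gaussianProduct ι) := by
  refine memLp_top_of_bound ?_ 1 (.of_forall fun z => (Complex.norm_exp_ofReal_mul_I _).le)
  have h := (Lp.aestronglyMeasurable (gaussianField e ξ)).const_mul √2
  exact Complex.continuous_exp.comp_aestronglyMeasurable
    ((Complex.continuous_ofReal.comp_aestronglyMeasurable h).mul_const Complex.I)

/-- The unitary `ω(ξ) ∈ L^∞(Z, ν)`; the map `ω` is the continuous extension to `H` of the map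
`∑ cₙ eₙ ↦ (z ↦ exp(√2 i ∑ cₙ zₙ))` on finite linear combinations of the basis. -/
def omega (e : HilbertBasis ι ℝ H) (ξ : H) : Lp ℂ ∞ (gaussianProduct ι) :=
  (memLp_omegaFun e ξ).toLp

theorem coeFn_omega (e : HilbertBasis ι ℝ H) (ξ : H) :
    omega e ξ =ᵐ[gaussianProduct ι] omegaFun e ξ :=
  (memLp_omegaFun e ξ).coeFn_toLp

theorem norm_omega_le (e : HilbertBasis ι ℝ H) (ξ : H) : ‖omega e ξ‖ ≤ 1 := by
  refine Lp.norm_le_of_ae_bound zero_le_one ?_ |>.trans (by simp)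
  filter_upwards [coeFn_omega e ξ] with z hz
  rw [hz]
  exact (Complex.norm_exp_ofReal_mul_I _).le

theorem omega_add (e : HilbertBasis ι ℝ H) (ξ η : H) :
    omega e (ξ + η) =ᵐ[gaussianProduct ι] fun z => omega e ξ z * omega e η z := by
  filter_upwards [coeFn_omega e (ξ + η), coeFn_omega e ξ, coeFn_omega e η,
    Lp.coeFn_add (gaussianField e ξ) (gaussianField e η)] with z h1 h2 h3 h4
  rw [h1, h2, h3, omegaFun, omegaFun, omegaFun, map_add, h4, ← Complex.exp_add]
  congr 1
  simp only [Pi.add_apply]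
  push_cast
  ring

theorem omega_zero (e : HilbertBasis ι ℝ H) :
    omega e 0 =ᵐ[gaussianProduct ι] fun _ => 1 := by
  filter_upwards [coeFn_omega e 0, Lp.coeFn_zero ℝ 2 (gaussianProduct ι)] with z h1 h2
  rw [h1, omegaFun, map_zero, h2]
  simp

theorem omega_neg (e : HilbertBasis ι ℝ H) (ξ : H) :
    omega e (-ξ) =ᵐ[gaussianProduct ι] fun z => starRingEnd ℂ (omega e ξ z) := by
  filter_upwards [coeFn_omega e (-ξ), coeFn_omega e ξ,
    Lp.coeFn_neg (gaussianField e ξ)] with z h1 h2 h3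
  rw [h1, h2, omegaFun, omegaFun, map_neg, h3, ← Complex.exp_conj]
  congr 1
  simp

end Gaussian

/-! ### The algebras `M ⊆ M̃` -/

section Construction

variable {Γ ι H X : Type*} [NormedAddCommGroup H] [InnerProductSpace ℝ H] [MeasurableSpace X]

/-- The Hilbert space `ℓ²(Γ) ⊗ L²(Z × X, ν × μ) = ℓ²(Γ, L²(Z × X))` on which
`M̃ = (D ⊗ A) ⋊ Γ` acts by the regular representation of the crossed product. -/
abbrev Space (Γ ι : Type*) {X : Type*} [MeasurableSpace X] (μ : Measure X) : Type _ :=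
  lp (fun _ : Γ => Lp ℂ 2 ((gaussianProduct ι).prod μ)) 2

/-- The bounded operators on `ℓ²(Γ, L²(Z × X))`. -/
abbrev Op (Γ ι : Type*) {X : Type*} [MeasurableSpace X] (μ : Measure X) : Type _ :=
  Space Γ ι μ →L[ℂ] Space Γ ι μ

variable (μ : Measure X)

/-- The diagonal operator `(φ f)(g) = φ_g · f(g)` for a bounded family `φ_g ∈ L^∞(Z × X)`. -/
def diagOp (φ : Γ → Lp ℂ ∞ ((gaussianProduct ι).prod μ)) {C : ℝ} (hC : 0 ≤ C)
    (hφ : ∀ g, ‖φ g‖ ≤ C) : Op Γ ι μ :=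
  lp.mapCLM 2 (fun g => mulOp (φ g)) hC fun g => (norm_mulOp_le (φ g)).trans (hφ g)

@[simp]
theorem diagOp_apply (φ : Γ → Lp ℂ ∞ ((gaussianProduct ι).prod μ)) {C : ℝ} (hC : 0 ≤ C)
    (hφ : ∀ g, ‖φ g‖ ≤ C) (f : Space Γ ι μ) (g : Γ) :
    diagOp μ φ hC hφ f g = mulOp (φ g) (f g) := rfl

variable [Group Γ]

theorem memlp_shift (h : Γ) (f : Space Γ ι μ) :
    Memℓp (fun g => f (h⁻¹ * g)) 2 := by
  have hf := (lp.memℓp f).summable (by norm_num)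
  refine memℓp_gen ?_
  exact (Equiv.mulLeft h⁻¹).summable_iff.2 hf

/-- The canonical unitary `u_h` of the crossed product: `(u_h f)(g) = f(h⁻¹ g)`. -/
def groupUnitary (ι : Type*) (h : Γ) : Op Γ ι μ :=
  LinearMap.mkContinuous
    { toFun := fun f => (⟨fun g => f (h⁻¹ * g), memlp_shift μ h f⟩ : Space Γ ι μ)
      map_add' := fun _ _ => by ext1; rfl
      map_smul' := fun _ _ => by ext1; rfl } 1 fun f => by
    rw [one_mul]
    refine le_of_eq ?_
    rw [lp.norm_eq_tsum_rpow (by norm_num), lp.norm_eq_tsum_rpow (by norm_num)]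
    congr 1
    exact (Equiv.mulLeft h⁻¹).tsum_eq (fun g => ‖f g‖ ^ (2 : ℝ≥0∞).toReal)

@[simp]
theorem groupUnitary_apply (h : Γ) (f : Space Γ ι μ) (g : Γ) :
    groupUnitary μ ι h f g = f (h⁻¹ * g) := rfl

section Base

variable [IsProbabilityMeasure μ]

/-- `ω(ξ) ⊗ 1 ∈ L^∞(Z × X)`. -/
def omegaTensorOne (e : HilbertBasis ι ℝ H) (ξ : H) : Lp ℂ ∞ ((gaussianProduct ι).prod μ) :=
  Lp.compMeasurePreserving Prod.fst measurePreserving_fst (omega e ξ)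

/-- `1 ⊗ a ∈ L^∞(Z × X)`. -/
def oneTensor (ι : Type*) (a : Lp ℂ ∞ μ) : Lp ℂ ∞ ((gaussianProduct ι).prod μ) :=
  Lp.compMeasurePreserving Prod.snd measurePreserving_snd a

theorem norm_omegaTensorOne_le (e : HilbertBasis ι ℝ H) (ξ : H) :
    ‖omegaTensorOne μ e ξ‖ ≤ 1 := by
  rw [omegaTensorOne, Lp.norm_compMeasurePreserving]
  exact norm_omega_le e ξ

theorem coeFn_omegaTensorOne (e : HilbertBasis ι ℝ H) (ξ : H) :
    omegaTensorOne μ e ξ =ᵐ[(gaussianProduct ι).prod μ] fun y => omega e ξ y.1 :=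
  Lp.coeFn_compMeasurePreserving _ _

theorem omegaTensorOne_add (e : HilbertBasis ι ℝ H) (ξ η : H) :
    omegaTensorOne μ e (ξ + η) =ᵐ[(gaussianProduct ι).prod μ]
      fun y => omegaTensorOne μ e ξ y * omegaTensorOne μ e η y := by
  filter_upwards [coeFn_omegaTensorOne μ e (ξ + η), coeFn_omegaTensorOne μ e ξ,
    coeFn_omegaTensorOne μ e η, (measurePreserving_fst (μ := gaussianProduct ι)
      (ν := μ)).quasiMeasurePreserving.ae (omega_add e ξ η)] with y h1 h2 h3 h4
  rw [h1, h2, h3, h4]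

theorem omegaTensorOne_zero (e : HilbertBasis ι ℝ H) :
    omegaTensorOne μ e 0 =ᵐ[(gaussianProduct ι).prod μ] fun _ => 1 := by
  filter_upwards [coeFn_omegaTensorOne μ e 0, (measurePreserving_fst (μ := gaussianProduct ι)
      (ν := μ)).quasiMeasurePreserving.ae (omega_zero e)] with y h1 h2
  rw [h1, h2]

theorem omegaTensorOne_neg (e : HilbertBasis ι ℝ H) (ξ : H) :
    omegaTensorOne μ e (-ξ) =ᵐ[(gaussianProduct ι).prod μ]
      fun y => starRingEnd ℂ (omegaTensorOne μ e ξ y) := by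
  filter_upwards [coeFn_omegaTensorOne μ e (-ξ), coeFn_omegaTensorOne μ e ξ,
    (measurePreserving_fst (μ := gaussianProduct ι)
      (ν := μ)).quasiMeasurePreserving.ae (omega_neg e ξ)] with y h1 h2 h3
  rw [h1, h2, h3]

/-- The operator of `ω(ξ) ⊗ 1 ∈ D ⊗ A` in the crossed product. For the Gaussian action
`σ_g(ω(ξ)) = ω(π(g) ξ)` it is `(x f)(g) = σ_{g⁻¹}(x) f(g)` with `x = ω(ξ) ⊗ 1`. -/
def omegaOp (e : HilbertBasis ι ℝ H) (π : Γ →* (H ≃ₗᵢ[ℝ] H)) (ξ : H) : Op Γ ι μ :=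
  diagOp μ (fun g => omegaTensorOne μ e (π g⁻¹ ξ)) zero_le_one
    fun _ => norm_omegaTensorOne_le μ e _

variable [MulAction Γ X] [MeasurableConstSMul Γ X] [SMulInvariantMeasure Γ X μ]

/-- The action `(σ_g a)(x) = a(g⁻¹ x)` of `Γ` on `A = L^∞(X, μ)`. -/
def translate (g : Γ) (a : Lp ℂ ∞ μ) : Lp ℂ ∞ μ :=
  Lp.compMeasurePreserving (fun x => g⁻¹ • x) (measurePreserving_smul g⁻¹ μ) a

/-- The operator of `1 ⊗ a ∈ D ⊗ A` in the crossed product: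
`(x f)(g) = σ_{g⁻¹}(x) f(g)` with `x = 1 ⊗ a`. -/
def functionOp (Γ ι : Type*) [Group Γ] [MulAction Γ X] [MeasurableConstSMul Γ X]
    [SMulInvariantMeasure Γ X μ] (a : Lp ℂ ∞ μ) : Op Γ ι μ :=
  diagOp μ (fun g => oneTensor μ ι (translate μ g⁻¹ a)) (norm_nonneg a) fun g => by
    rw [oneTensor, translate, Lp.norm_compMeasurePreserving, Lp.norm_compMeasurePreserving]

/-- The von Neumann algebra `D ⊗ A` inside the crossed product `M̃`: it is generated by the
elements `ω(ξ) ⊗ 1` and `1 ⊗ a`, because `D` is generated by the `ω(ξ)`, `ξ ∈ H`, and because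
`x ↦ (σ_{g⁻¹}(x))_g` is a normal faithful representation of `D ⊗ A`. -/
def baseAlgebra (e : HilbertBasis ι ℝ H) (π : Γ →* (H ≃ₗᵢ[ℝ] H)) :
    VonNeumannAlgebra (Space Γ ι μ) :=
  vnGenerated (Set.range (omegaOp μ e π) ∪ Set.range (functionOp μ Γ ι))

/-- The crossed product `M̃ = (D ⊗ A) ⋊ Γ`, generated by `D ⊗ A` and the unitaries `u_g`. -/
def bigAlgebra (e : HilbertBasis ι ℝ H) (π : Γ →* (H ≃ₗᵢ[ℝ] H)) :
    VonNeumannAlgebra (Space Γ ι μ) :=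
  vnGenerated ((baseAlgebra μ e π : Set (Op Γ ι μ)) ∪ Set.range (groupUnitary μ ι))

/-- The crossed product `M = A ⋊ Γ`, identified with the von Neumann subalgebra `(1 ⊗ A) ⋊ Γ` of
`M̃` generated by `1 ⊗ A` and the unitaries `u_g`. -/
def smallAlgebra (Γ ι : Type*) [Group Γ] [MulAction Γ X] [MeasurableConstSMul Γ X]
    [SMulInvariantMeasure Γ X μ] : VonNeumannAlgebra (Space Γ ι μ) :=
  vnGenerated (Set.range (functionOp μ Γ ι) ∪ Set.range (groupUnitary μ ι))

end Base

/-! ### The trace, the 2-norm and conditional expectations -/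

section Trace

variable {μ}

open Classical in
/-- The vector `δ_e ⊗ 1`, which implements the trace of `M̃`. -/
def traceVector (Γ ι : Type*) [Group Γ] (μ : Measure X) [IsProbabilityMeasure μ] :
    Space Γ ι μ :=
  lp.single 2 (1 : Γ) (Lp.const 2 ((gaussianProduct ι).prod μ) (1 : ℂ))

variable [IsProbabilityMeasure μ]

/-- The trace `τ(∑_g x_g u_g) = ∫ x_e d(ν × μ)` of `M̃`. -/
def trace (x : Op Γ ι μ) : ℂ := ⟪traceVector Γ ι μ, x (traceVector Γ ι μ)⟫_ℂ

/-- The 2-norm `‖x‖₂ = τ(x* x)^{1/2}`. -/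
def norm2 (x : Op Γ ι μ) : ℝ := √(trace (star x * x)).re

open Classical in
/-- The trace preserving conditional expectation `E_N` of `M̃` onto a von Neumann subalgebra `N`:
for `x ∈ M̃`, `E_N(x)` is the unique `y ∈ N` such that `τ(n y) = τ(n x)` for all `n ∈ N`. -/
def condExp (N : VonNeumannAlgebra (Space Γ ι μ)) (x : Op Γ ι μ) : Op Γ ι μ :=
  if h : ∃ y ∈ N, ∀ n ∈ N, trace (n * y) = trace (n * x) then h.choose else 0

end Trace

/-! ### The deformation `α_t` -/

section Deformation

variable [IsProbabilityMeasure μ]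

/-- The diagonal operator `(V_t f)(g) = (ω(-t b(g⁻¹)) ⊗ 1) f(g)`. -/
def deformationOp (e : HilbertBasis ι ℝ H) (b : Γ → H) (t : ℝ) : Op Γ ι μ :=
  diagOp μ (fun g => omegaTensorOne μ e (-(t • b g⁻¹))) zero_le_one
    fun _ => norm_omegaTensorOne_le μ e _

theorem star_deformationOp (e : HilbertBasis ι ℝ H) (b : Γ → H) (t : ℝ) :
    star (deformationOp μ e b t) = deformationOp μ e b (-t) := by
  rw [ContinuousLinearMap.star_eq_adjoint, eq_comm, ContinuousLinearMap.eq_adjoint_iff]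
  intro f f'
  rw [lp.inner_eq_tsum, lp.inner_eq_tsum]
  congr 1
  ext g
  refine inner_mulOp_of_ae ?_ _ _
  have h := omegaTensorOne_neg μ e (-(-t • b g⁻¹))
  convert h using 3
  simp

theorem deformationOp_mul_neg (e : HilbertBasis ι ℝ H) (b : Γ → H) (t : ℝ) :
    deformationOp μ e b t * deformationOp μ e b (-t) = 1 := by
  ext1 f
  refine lp.ext (funext fun g => ?_)
  change mulOp _ (mulOp _ (f g)) = f g
  have h := omegaTensorOne_add μ e (-(t • b g⁻¹)) (-(-t • b g⁻¹))
  rw [mulOp_comp_of_ae h]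
  refine mulOp_eq_self ?_ _
  simpa using omegaTensorOne_zero μ e

theorem deformationOp_mem_unitary (e : HilbertBasis ι ℝ H) (b : Γ → H) (t : ℝ) :
    deformationOp μ e b t ∈ unitary (Op Γ ι μ) := by
  rw [Unitary.mem_iff, star_deformationOp]
  exact ⟨by simpa using deformationOp_mul_neg μ e b (-t), deformationOp_mul_neg μ e b t⟩

theorem deformationOp_commute_diagOp (e : HilbertBasis ι ℝ H) (b : Γ → H) (t : ℝ)
    (φ : Γ → Lp ℂ ∞ ((gaussianProduct ι).prod μ)) {C : ℝ} (hC : 0 ≤ C) (hφ : ∀ g, ‖φ g‖ ≤ C) :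
    diagOp μ φ hC hφ * deformationOp μ e b t = deformationOp μ e b t * diagOp μ φ hC hφ := by
  ext1 f
  exact lp.ext (funext fun g => mulOp_comm _ _ _)

/-- The deformation `α_t`, realised as conjugation by the unitary `V_t`. It maps `M̃` onto `M̃`
(`deformation_mem_iff`), and on `M̃` it is the automorphism with
`α_t = id` on `D ⊗ A` (`deformation_of_mem_base`) and
`α_t(u_g) = (ω(t b(g)) ⊗ 1) u_g` (`deformation_groupUnitary`). -/
def deformation (e : HilbertBasis ι ℝ H) (b : Γ → H) (t : ℝ) : Op Γ ι μ ≃⋆ₐ[ℂ] Op Γ ι μ :=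
  Unitary.conjStarAlgAut ℂ (Op Γ ι μ) ⟨deformationOp μ e b t, deformationOp_mem_unitary μ e b t⟩

theorem deformation_apply (e : HilbertBasis ι ℝ H) (b : Γ → H) (t : ℝ) (x : Op Γ ι μ) :
    deformation μ e b t x = deformationOp μ e b t * x * deformationOp μ e b (-t) := by
  rw [← star_deformationOp]
  rfl

theorem deformation_neg_deformation (e : HilbertBasis ι ℝ H) (b : Γ → H) (t : ℝ) (x : Op Γ ι μ) :
    deformation μ e b (-t) (deformation μ e b t x) = x := by
  have h := deformationOp_mul_neg μ e b (-t)
  rw [neg_neg] at h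
  simp only [deformation_apply, neg_neg]
  calc _ = (deformationOp μ e b (-t) * deformationOp μ e b t) * x *
        (deformationOp μ e b (-t) * deformationOp μ e b t) := by simp only [mul_assoc]
    _ = x := by rw [h, one_mul, mul_one]

/-- Covariance on `D`: `u_h (ω(ξ) ⊗ 1) u_h* = ω(π(h) ξ) ⊗ 1`. -/
theorem groupUnitary_mul_omegaOp (e : HilbertBasis ι ℝ H) (π : Γ →* (H ≃ₗᵢ[ℝ] H)) (h : Γ)
    (ξ : H) : groupUnitary μ ι h * omegaOp μ e π ξ =
      omegaOp μ e π (π h ξ) * groupUnitary μ ι h := by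
  ext1 f
  refine lp.ext (funext fun g => ?_)
  change mulOp (omegaTensorOne μ e (π (h⁻¹ * g)⁻¹ ξ)) (f (h⁻¹ * g)) =
    mulOp (omegaTensorOne μ e (π g⁻¹ (π h ξ))) (f (h⁻¹ * g))
  have : π (h⁻¹ * g)⁻¹ ξ = π g⁻¹ (π h ξ) := by
    rw [mul_inv_rev, inv_inv, map_mul]
    rfl
  rw [this]

theorem deformation_groupUnitary (e : HilbertBasis ι ℝ H) (π : Γ →* (H ≃ₗᵢ[ℝ] H)) (b : Γ → H)
    (hb : ∀ g h, b (g * h) = π g (b h) + b g) (t : ℝ) (h : Γ) :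
    deformation μ e b t (groupUnitary μ ι h) =
      omegaOp μ e π (t • b h) * groupUnitary μ ι h := by
  rw [deformation_apply]
  ext1 f
  refine lp.ext (funext fun g => ?_)
  change mulOp (omegaTensorOne μ e (-(t • b g⁻¹)))
      (mulOp (omegaTensorOne μ e (-(-t • b (h⁻¹ * g)⁻¹))) (f (h⁻¹ * g))) =
    mulOp (omegaTensorOne μ e (π g⁻¹ (t • b h))) (f (h⁻¹ * g))
  rw [mulOp_comp_of_ae (omegaTensorOne_add μ e _ _)]
  congr 3
  rw [mul_inv_rev, inv_inv, hb, map_smul, smul_add, neg_smul, neg_smul, neg_add, neg_neg, neg_neg]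
  abel

variable [MulAction Γ X] [MeasurableConstSMul Γ X] [SMulInvariantMeasure Γ X μ]

/-- Covariance on `A`: `u_h (1 ⊗ a) u_h* = 1 ⊗ σ_h(a)`. -/
theorem groupUnitary_mul_functionOp (h : Γ) (a : Lp ℂ ∞ μ) :
    groupUnitary μ ι h * functionOp μ Γ ι a =
      functionOp μ Γ ι (translate μ h a) * groupUnitary μ ι h := by
  ext1 f
  refine lp.ext (funext fun g => ?_)
  change mulOp (oneTensor μ ι (translate μ (h⁻¹ * g)⁻¹ a)) (f (h⁻¹ * g)) =
    mulOp (oneTensor μ ι (translate μ g⁻¹ (translate μ h a))) (f (h⁻¹ * g))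
  have : translate μ (h⁻¹ * g)⁻¹ a = translate μ g⁻¹ (translate μ h a) := by
    rw [translate, translate, translate, ← Lp.compMeasurePreserving_comp_apply]
    congr 2
    ext x
    simp [mul_smul]
  rw [this]

theorem functionOp_mem_smallAlgebra (a : Lp ℂ ∞ μ) :
    functionOp μ Γ ι a ∈ smallAlgebra μ Γ ι :=
  subset_vnGenerated _ (.inl ⟨a, rfl⟩)

theorem groupUnitary_mem_smallAlgebra (h : Γ) : groupUnitary μ ι h ∈ smallAlgebra μ Γ ι :=
  subset_vnGenerated _ (.inr ⟨h, rfl⟩)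

theorem smallAlgebra_le_bigAlgebra (e : HilbertBasis ι ℝ H) (π : Γ →* (H ≃ₗᵢ[ℝ] H)) :
    smallAlgebra μ Γ ι ≤ bigAlgebra μ e π := by
  refine vnGenerated_le ?_
  rintro _ (⟨a, rfl⟩ | ⟨h, rfl⟩)
  · exact subset_vnGenerated _ (.inl (subset_vnGenerated _ (.inr ⟨a, rfl⟩)))
  · exact subset_vnGenerated _ (.inr ⟨h, rfl⟩)

/-- `α_t` is the identity on `D ⊗ A`. -/
theorem deformation_of_mem_base (e : HilbertBasis ι ℝ H) (π : Γ →* (H ≃ₗᵢ[ℝ] H)) (b : Γ → H)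
    (t : ℝ) {x : Op Γ ι μ} (hx : x ∈ baseAlgebra μ e π) : deformation μ e b t x = x := by
  have key : ∀ s : ℝ, ∀ y ∈ Set.range (omegaOp μ e π) ∪ Set.range (functionOp μ Γ ι),
      y * deformationOp μ e b s = deformationOp μ e b s * y := by
    rintro s _ (⟨ξ, rfl⟩ | ⟨a, rfl⟩)
    · exact deformationOp_commute_diagOp μ e b s _ _ _
    · exact deformationOp_commute_diagOp μ e b s _ _ _
  have hV : deformationOp μ e b t ∈
      commutantOf (Set.range (omegaOp μ e π) ∪ Set.range (functionOp μ Γ ι)) := by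
    refine mem_commutantOf.2 fun s hs => ⟨key t s hs, ?_⟩
    have h := congrArg star (key (-t) s hs)
    rw [star_mul, star_mul, star_deformationOp, neg_neg] at h
    exact h.symm
  rw [deformation_apply, mem_vnGenerated.1 hx _ hV, mul_assoc, deformationOp_mul_neg, mul_one]

theorem deformation_mem (e : HilbertBasis ι ℝ H) (π : Γ →* (H ≃ₗᵢ[ℝ] H)) (b : Γ → H)
    (hb : ∀ g h, b (g * h) = π g (b h) + b g) (t : ℝ) {x : Op Γ ι μ}
    (hx : x ∈ bigAlgebra μ e π) : deformation μ e b t x ∈ bigAlgebra μ e π := by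
  have hgen : ∀ y ∈ (baseAlgebra μ e π : Set (Op Γ ι μ)) ∪ Set.range (groupUnitary μ ι),
      deformation μ e b t y ∈ bigAlgebra μ e π := by
    rintro _ (hy | ⟨h, rfl⟩)
    · rw [deformation_of_mem_base μ e π b t hy]
      exact subset_vnGenerated _ (.inl hy)
    · rw [deformation_groupUnitary μ e π b hb]
      exact mul_mem (subset_vnGenerated _ (.inl (subset_vnGenerated _ (.inl ⟨_, rfl⟩))))
        (subset_vnGenerated _ (.inr ⟨h, rfl⟩))
  refine mem_vnGenerated.2 fun z hz => ?_
  have hz' : deformation μ e b (-t) z ∈ commutantOf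
      ((baseAlgebra μ e π : Set (Op Γ ι μ)) ∪ Set.range (groupUnitary μ ι)) := by
    refine mem_commutantOf.2 fun s hs => ?_
    have h1 := mem_vnGenerated.1 (hgen s hs) z hz
    have h2 := mem_vnGenerated.1 (star_mem (hgen s hs)) z hz
    rw [← map_star] at h2
    have h1' := congrArg (deformation μ e b (-t)) h1
    have h2' := congrArg (deformation μ e b (-t)) h2
    simp only [map_mul, deformation_neg_deformation] at h1' h2'
    exact ⟨h1'.symm, h2'.symm⟩
  have h := congrArg (deformation μ e b t) (mem_vnGenerated.1 hx _ hz')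
  have hinv := deformation_neg_deformation μ e b (-t) z
  rw [neg_neg] at hinv
  simpa only [map_mul, hinv] using h

/-- `α_t` restricts to an automorphism of `M̃`. -/
theorem deformation_mem_iff (e : HilbertBasis ι ℝ H) (π : Γ →* (H ≃ₗᵢ[ℝ] H)) (b : Γ → H)
    (hb : ∀ g h, b (g * h) = π g (b h) + b g) (t : ℝ) {x : Op Γ ι μ} :
    deformation μ e b t x ∈ bigAlgebra μ e π ↔ x ∈ bigAlgebra μ e π := by
  refine ⟨fun h => ?_, deformation_mem μ e π b hb t⟩
  have := deformation_mem μ e π b hb (-t) h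
  rwa [deformation_neg_deformation] at this

end Deformation

end Construction

end GaussianDeformation

end

/-
The trace vector `Ω = δ_e ⊗ 1` is tracial and separating for `M̃`: the commutant contains the right
multiplications by `L^∞(Z × X)` and by the `u_h*`, and these move `Ω` onto a total set. On `M` the
map `E_M ∘ α_t` is the multiplier `u_g ↦ exp(-‖t b(g)‖²) u_g`, because `∫ ω(ξ) dν = exp(-‖ξ‖²)`.
Since its values lie in `[0, 1]`, the square of `‖E_M(α_t(x))‖₂` is at most
`Re τ(x* α_t(x)) = Re τ(α_t(x) x*)`, so that `Re τ(α_t(x) x*) ≥ δ²` for every unitary `x ∈ Q`. This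
inequality passes to the closed convex hull of the `α_t(x) x* Ω`, whose element of minimal norm is
`y Ω` for some `y ∈ M̃`. Hence `y ≠ 0`, and `α_t(x) y x* = y` by uniqueness of the minimizer. The
polar part of `y` is the desired partial isometry.
-/

noncomputable section

namespace GaussianDeformation

section Factorization

variable {𝕜 E F G : Type*} [RCLike 𝕜] [NormedAddCommGroup E] [InnerProductSpace 𝕜 E]
  [CompleteSpace E] [NormedAddCommGroup F] [NormedSpace 𝕜 F] [NormedAddCommGroup G]
  [NormedSpace 𝕜 G]

theorem ext_of_range_of_ker {a b : E →L[𝕜] F} {p : E →L[𝕜] E} (hp : IsSelfAdjoint p)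
    (hrange : a ∘L p = b ∘L p) (hker : ∀ ζ, p ζ = 0 → a ζ = b ζ) :
    a = b := by
  have hcl : p.range.topologicalClosure ≤ (a - b).ker := by
    refine Submodule.topologicalClosure_minimal _ ?_ (a - b).isClosed_ker
    rintro _ ⟨ζ, rfl⟩
    simpa [sub_eq_zero] using congr($hrange ζ)
  have hperp : p.range.topologicalClosureᗮ ≤ (a - b).ker := by
    rw [Submodule.orthogonal_closure, p.orthogonal_range, ← ContinuousLinearMap.star_eq_adjoint,
      hp.star_eq]
    exact fun ζ hζ => sub_eq_zero.2 (hker ζ hζ)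
  have : CompleteSpace p.range.topologicalClosure :=
    (Submodule.isClosed_topologicalClosure _).completeSpace_coe
  have htop : (a - b).ker = ⊤ := by
    rw [eq_top_iff, ← p.range.topologicalClosure.sup_orthogonal_of_hasOrthogonalProjection]
    exact sup_le hcl hperp
  ext ζ
  exact sub_eq_zero.1 (htop ▸ Submodule.mem_top : ζ ∈ (a - b).ker)

/-- Douglas' factorization lemma. -/
theorem exists_comp_eq_of_norm_apply_le [CompleteSpace F] {y : G →L[𝕜] F} {p : G →L[𝕜] E}
    (h : ∀ ζ, ‖y ζ‖ ≤ ‖p ζ‖) : ∃ v : E →L[𝕜] F, v ∘L p = y ∧ ∀ ζ ∈ p.rangeᗮ, v ζ = 0 := by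
  let S : Submodule 𝕜 E := p.range.topologicalClosure
  have : CompleteSpace S := (Submodule.isClosed_topologicalClosure _).completeSpace_coe
  let p' : G →ₗ[𝕜] S := (p : G →ₗ[𝕜] E).codRestrict S fun ζ =>
    Submodule.le_topologicalClosure _ ⟨ζ, rfl⟩
  have hp' : DenseRange p' := by
    intro x
    rw [closure_subtype]
    refine closure_mono ?_ x.2
    rintro _ ⟨ζ, rfl⟩
    exact ⟨p' ζ, ⟨ζ, rfl⟩, rfl⟩
  have hextend : ∀ ζ, (y : G →ₗ[𝕜] F).extendOfNorm p' (p' ζ) = y ζ :=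
    LinearMap.extendOfNorm_eq hp' ⟨1, fun ζ => (h ζ).trans (one_mul _).ge⟩
  refine ⟨(y : G →ₗ[𝕜] F).extendOfNorm p' ∘L S.orthogonalProjectionOnto, ?_, fun ζ hζ => ?_⟩
  · ext ζ
    have hproj : S.orthogonalProjectionOnto (p ζ) = p' ζ :=
      S.orthogonalProjectionOnto_mem_subspace_eq_self (p' ζ)
    change (y : G →ₗ[𝕜] F).extendOfNorm p' (S.orthogonalProjectionOnto (p ζ)) = y ζ
    rw [hproj, hextend]
  · rw [ContinuousLinearMap.comp_apply, S.orthogonalProjectionOnto_eq_zero_iff.2, map_zero]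
    rwa [Submodule.orthogonal_closure]

end Factorization

section PolarDecomposition

variable {K : Type*} [NormedAddCommGroup K] [InnerProductSpace ℂ K] [CompleteSpace K]

theorem isSelfAdjoint_abs (y : K →L[ℂ] K) : IsSelfAdjoint (CFC.abs y) :=
  (CFC.abs_nonneg y).isSelfAdjoint

theorem norm_abs_apply (y : K →L[ℂ] K) (ζ : K) : ‖CFC.abs y ζ‖ = ‖y ζ‖ := by
  have hinner : ⟪CFC.abs y ζ, CFC.abs y ζ⟫_ℂ = ⟪y ζ, y ζ⟫_ℂ := by
    rw [← ContinuousLinearMap.adjoint_inner_right, ← ContinuousLinearMap.adjoint_inner_right y,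
      ← ContinuousLinearMap.star_eq_adjoint, ← ContinuousLinearMap.star_eq_adjoint,
      (isSelfAdjoint_abs y).star_eq, ← mul_apply_eq_comp, ← mul_apply_eq_comp,
      CFC.abs_mul_abs]
  rw [inner_self_eq_norm_sq_to_K, inner_self_eq_norm_sq_to_K] at hinner
  exact (sq_eq_sq₀ (norm_nonneg _) (norm_nonneg _)).1 (mod_cast hinner)

/-- The partial isometry `v` of the polar decomposition `y = v|y|`; it is determined by vanishing
on the kernel of `|y|`. -/
structure IsPolarPart (y v : K →L[ℂ] K) : Prop where
  mul_abs : v * CFC.abs y = y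
  apply_eq_zero : ∀ ζ, CFC.abs y ζ = 0 → v ζ = 0

theorem exists_isPolarPart (y : K →L[ℂ] K) : ∃ v, IsPolarPart y v := by
  obtain ⟨v, hv, hv0⟩ := exists_comp_eq_of_norm_apply_le fun ζ => (norm_abs_apply y ζ).ge
  refine ⟨v, hv, fun ζ hζ => hv0 ζ ?_⟩
  rwa [ContinuousLinearMap.orthogonal_range, ← ContinuousLinearMap.star_eq_adjoint,
    (isSelfAdjoint_abs y).star_eq]

namespace IsPolarPart

variable {y v : K →L[ℂ] K}

theorem star_mul_mul_abs (h : IsPolarPart y v) : star v * v * CFC.abs y = CFC.abs y := by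
  have hsa := (isSelfAdjoint_abs y).star_eq
  have hstar : CFC.abs y * (star v * v) = CFC.abs y := by
    refine ext_of_range_of_ker (isSelfAdjoint_abs y) ?_ fun ζ hζ => ?_
    · calc CFC.abs y * (star v * v) * CFC.abs y
          = star (v * CFC.abs y) * (v * CFC.abs y) := by rw [star_mul, hsa]; simp only [mul_assoc]
        _ = CFC.abs y * CFC.abs y := by rw [h.mul_abs, CFC.abs_mul_abs]
    · simp [h.apply_eq_zero ζ hζ, hζ]
  simpa [hsa] using congr(star $hstar)

theorem mul_star_mul (h : IsPolarPart y v) : v * star v * v = v := by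
  refine ext_of_range_of_ker (isSelfAdjoint_abs y) ?_ fun ζ hζ => ?_
  · change v * star v * v * CFC.abs y = v * CFC.abs y
    rw [mul_assoc v, mul_assoc v, h.star_mul_mul_abs]
  · simp [h.apply_eq_zero ζ hζ]

theorem ne_zero (h : IsPolarPart y v) (hy : y ≠ 0) : v ≠ 0 := by
  rintro rfl
  exact hy (by rw [← h.mul_abs, zero_mul])

theorem mul_eq_mul (h : IsPolarPart y v) {a c : K →L[ℂ] K} (hac : a * y = y * c)
    (hac' : star a * y = y * star c) : a * v = v * c := by
  have hc : Commute (star y * y) c := by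
    have hstar : star y * a = c * star y := by simpa using congr(star $hac')
    change star y * y * c = c * (star y * y)
    rw [mul_assoc, ← hac, ← mul_assoc, hstar, mul_assoc]
  have habs : CFC.abs y * c = c * CFC.abs y := by
    rw [CFC.abs, CFC.sqrt_eq_nnrpow]
    exact hc.cfcₙ_nnreal _
  refine ext_of_range_of_ker (isSelfAdjoint_abs y) ?_ fun ζ hζ => ?_
  · change a * v * CFC.abs y = v * c * CFC.abs y
    rw [mul_assoc, h.mul_abs, mul_assoc, ← habs, ← mul_assoc, h.mul_abs, hac]
  · have hcζ : CFC.abs y (c ζ) = 0 := by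
      rw [← mul_apply_eq_comp, habs, mul_apply_eq_comp, hζ, map_zero]
    simp [h.apply_eq_zero ζ hζ, h.apply_eq_zero _ hcζ]

theorem mem (h : IsPolarPart y v) {N : VonNeumannAlgebra K} (hy : y ∈ N) : v ∈ N := by
  rw [← VonNeumannAlgebra.commutant_commutant N, VonNeumannAlgebra.mem_commutant_iff]
  exact fun z hz => h.mul_eq_mul (VonNeumannAlgebra.mem_commutant_iff.1 hz y hy).symm
    (VonNeumannAlgebra.mem_commutant_iff.1 (star_mem hz) y hy).symm

end IsPolarPart

end PolarDecomposition

theorem exists_forall_norm_le_imp_eq {E : Type*} [NormedAddCommGroup E] [InnerProductSpace ℝ E]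
    {D : Set E} (hne : D.Nonempty) (hcomplete : IsComplete D) (hconv : Convex ℝ D) :
    ∃ ζ ∈ D, ∀ w ∈ D, ‖w‖ ≤ ‖ζ‖ → w = ζ := by
  obtain ⟨ζ, hζ, hmin⟩ := exists_norm_eq_iInf_of_complete_convex hne hcomplete hconv 0
  refine ⟨ζ, hζ, fun w hw hle => ?_⟩
  have hobtuse := (norm_eq_iInf_iff_real_inner_le_zero hconv hζ).1 hmin w hw
  rw [zero_sub, inner_neg_left, neg_nonpos] at hobtuse
  have hexpand : ‖w‖ ^ 2 = ‖ζ‖ ^ 2 + 2 * ⟪ζ, w - ζ⟫_ℝ + ‖w - ζ‖ ^ 2 := by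
    rw [← norm_add_sq_real, add_sub_cancel]
  have hnorm : ‖w - ζ‖ = 0 := by
    nlinarith [norm_nonneg w, norm_nonneg ζ, norm_nonneg (w - ζ)]
  exact sub_eq_zero.1 (norm_eq_zero.1 hnorm)

section Intertwiner

variable {K : Type*} [NormedAddCommGroup K] [InnerProductSpace ℂ K]

/-- Evaluation at `Ω`, as a real-linear map because it is applied to convex hulls. -/
def realEval (Ω : K) : (K →L[ℂ] K) →L[ℝ] K :=
  (ContinuousLinearMap.apply ℂ K Ω).restrictScalars ℝ

@[simp]
theorem realEval_apply (Ω : K) (a : K →L[ℂ] K) : realEval Ω a = a Ω := rfl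

theorem mul_mul_mem_convexHull {S : Set (K →L[ℂ] K)} {u w : K →L[ℂ] K}
    (h : ∀ a ∈ S, u * a * w ∈ S) {a : K →L[ℂ] K} (ha : a ∈ convexHull ℝ S) :
    u * a * w ∈ convexHull ℝ S :=
  convexHull_min (t := LinearMap.mulLeftRight ℝ (u, w) ⁻¹' convexHull ℝ S)
    (fun a ha => subset_convexHull ℝ S (h a ha)) ((convex_convexHull ℝ S).linear_preimage _) ha

theorem le_re_inner_of_mem_closure_convexHull {Ω : K} {S : Set (K →L[ℂ] K)} {c : ℝ}
    (hc : ∀ a ∈ S, c ≤ (⟪Ω, a Ω⟫_ℂ).re) {ζ : K}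
    (hζ : ζ ∈ closure (realEval Ω '' convexHull ℝ S)) : c ≤ (⟪Ω, ζ⟫_ℂ).re := by
  let f : K →L[ℝ] ℝ := Complex.reCLM ∘L (innerSL ℂ Ω).restrictScalars ℝ
  refine closure_minimal (t := f ⁻¹' Set.Ici c) ?_ (isClosed_Ici.preimage f.continuous) hζ
  rw [Set.image_subset_iff, ← Set.preimage_comp]
  exact convexHull_min hc (((convex_Ici c).linear_preimage f.toLinearMap).linear_preimage
    (realEval Ω).toLinearMap)

variable [CompleteSpace K]

/-- A vector `Ω` is separating for `N` when it is cyclic for the commutant of `N`; the latter is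
the form taken as definition. -/
def IsSeparatingVector (N : VonNeumannAlgebra K) (Ω : K) : Prop :=
  Dense ((fun z : K →L[ℂ] K => z Ω) '' N.commutant)

/-- The vector state `⟨Ω, · Ω⟩` is a trace on `N`. -/
def IsTraceVector (N : VonNeumannAlgebra K) (Ω : K) : Prop :=
  ∀ a ∈ N, ‖star a Ω‖ = ‖a Ω‖

variable {N Q : VonNeumannAlgebra K} {Ω : K}

theorem apply_apply_of_mem_commutant {z a : K →L[ℂ] K} (hz : z ∈ N.commutant) (ha : a ∈ N)
    (η : K) : z (a η) = a (z η) :=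
  congr($(VonNeumannAlgebra.mem_commutant_iff.1 hz a ha) η).symm

namespace IsSeparatingVector

theorem eq_of_apply_eq (hΩ : IsSeparatingVector N Ω) {x y : K →L[ℂ] K} (hx : x ∈ N) (hy : y ∈ N)
    (hxy : x Ω = y Ω) : x = y := by
  ext η
  refine hΩ.induction (P := fun η => x η = y η) ?_ (isClosed_eq (by fun_prop) (by fun_prop)) η
  rintro _ ⟨z, hz, rfl⟩
  rw [← apply_apply_of_mem_commutant hz hx, ← apply_apply_of_mem_commutant hz hy, hxy]

theorem exists_mem_apply_eq (hΩ : IsSeparatingVector N Ω) {ζ : K} {r : ℝ}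
    (hζ : ∀ z ∈ N.commutant, ‖z ζ‖ ≤ r * ‖z Ω‖) : ∃ y ∈ N, y Ω = ζ := by
  let ev (η : K) : N.commutant.toStarSubalgebra →ₗ[ℂ] K :=
    (ContinuousLinearMap.apply ℂ K η).toLinearMap ∘ₗ
      N.commutant.toStarSubalgebra.toSubalgebra.toSubmodule.subtype
  have hdense : DenseRange (ev Ω) := by
    refine hΩ.mono ?_
    rintro _ ⟨z, hz, rfl⟩
    exact ⟨⟨z, hz⟩, rfl⟩
  let y : K →L[ℂ] K := (ev ζ).extendOfNorm (ev Ω)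
  have hy : ∀ z : N.commutant.toStarSubalgebra, y (ev Ω z) = ev ζ z :=
    LinearMap.extendOfNorm_eq hdense ⟨r, fun z => hζ z z.2⟩
  refine ⟨y, ?_, hy 1⟩
  rw [← VonNeumannAlgebra.commutant_commutant N, VonNeumannAlgebra.mem_commutant_iff]
  intro z hz
  ext η
  refine hdense.induction_on (p := fun η => (z * y) η = (y * z) η) η
    (isClosed_eq (by fun_prop) (by fun_prop)) fun z' => ?_
  change z (y (ev Ω z')) = y (ev Ω (⟨z, hz⟩ * z'))
  rw [hy, hy]
  rfl

theorem exists_mem_apply_eq_of_mem_closure (hΩ : IsSeparatingVector N Ω) {C : Set (K →L[ℂ] K)}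
    (hCN : C ⊆ N) {r : ℝ} (hCr : ∀ a ∈ C, ‖a‖ ≤ r) {ζ : K} (hζ : ζ ∈ closure (realEval Ω '' C)) :
    ∃ y ∈ N, y Ω = ζ := by
  refine hΩ.exists_mem_apply_eq (r := r) fun z hz => ?_
  refine closure_minimal (t := {η | ‖z η‖ ≤ r * ‖z Ω‖}) ?_
    (isClosed_le (by fun_prop) (by fun_prop)) hζ
  rintro _ ⟨a, ha, rfl⟩
  change ‖z (a Ω)‖ ≤ r * ‖z Ω‖
  rw [apply_apply_of_mem_commutant hz (hCN ha)]
  exact a.le_of_opNorm_le (hCr a ha) _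

end IsSeparatingVector

namespace IsTraceVector

theorem norm_mul_mul_star_apply (hΩ : IsTraceVector N Ω) {a u w : K →L[ℂ] K} (ha : a ∈ N)
    (hu : u ∈ unitary (K →L[ℂ] K)) (hw : w ∈ unitary (K →L[ℂ] K)) (hwN : w ∈ N) :
    ‖(u * a * star w) Ω‖ = ‖a Ω‖ := by
  calc ‖(u * a * star w) Ω‖ = ‖(a * star w) Ω‖ := by
        rw [mul_assoc, mul_apply_eq_comp, ContinuousLinearMap.norm_map_of_mem_unitary hu]
    _ = ‖(w * star a) Ω‖ := by
        rw [← hΩ _ (mul_mem ha (star_mem hwN)), star_mul, star_star]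
    _ = ‖a Ω‖ := by
        rw [mul_apply_eq_comp, ContinuousLinearMap.norm_map_of_mem_unitary hw, hΩ a ha]

theorem mul_mul_star_apply_mem_closure (hΩ : IsTraceVector N Ω) {C : Set (K →L[ℂ] K)}
    (hCN : C ⊆ N) {u w : K →L[ℂ] K} (hu : u ∈ unitary (K →L[ℂ] K))
    (hw : w ∈ unitary (K →L[ℂ] K)) (hwN : w ∈ N) (hC : ∀ a ∈ C, u * a * star w ∈ C)
    {y : K →L[ℂ] K} (hy : y ∈ N) (hyC : y Ω ∈ closure (realEval Ω '' C)) :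
    (u * y * star w) Ω ∈ closure (realEval Ω '' C) := by
  rw [Metric.mem_closure_iff] at hyC ⊢
  intro ε hε
  obtain ⟨_, ⟨a, ha, rfl⟩, hdist⟩ := hyC ε hε
  refine ⟨_, ⟨u * a * star w, hC a ha, rfl⟩, ?_⟩
  rw [dist_eq_norm, realEval_apply, ← sub_apply] at hdist ⊢
  rwa [← sub_mul, ← mul_sub, hΩ.norm_mul_mul_star_apply (sub_mem hy (hCN ha)) hu hw hwN]

theorem re_inner_star_apply {a b : K →L[ℂ] K} (hΩ : IsTraceVector N Ω) (ha : a ∈ N) (hb : b ∈ N) :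
    (⟪star a Ω, star b Ω⟫_ℂ).re = (⟪a Ω, b Ω⟫_ℂ).re := by
  have hsub := hΩ (a - b) (sub_mem ha hb)
  rw [star_sub, sub_apply, sub_apply] at hsub
  have hexpand := norm_sub_sq (𝕜 := ℂ) (a Ω) (b Ω)
  have hexpand_star := norm_sub_sq (𝕜 := ℂ) (star a Ω) (star b Ω)
  rw [hsub, hΩ a ha, hΩ b hb] at hexpand_star
  change RCLike.re ⟪star a Ω, star b Ω⟫_ℂ = RCLike.re ⟪a Ω, b Ω⟫_ℂ
  linarith

theorem re_inner_mul_star_apply {a b : K →L[ℂ] K} (hΩ : IsTraceVector N Ω) (ha : a ∈ N)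
    (hb : b ∈ N) : (⟪Ω, (a * star b) Ω⟫_ℂ).re = (⟪b Ω, a Ω⟫_ℂ).re := by
  rw [mul_apply_eq_comp, ← ContinuousLinearMap.adjoint_inner_left,
    ← ContinuousLinearMap.star_eq_adjoint, hΩ.re_inner_star_apply ha hb, ← inner_conj_symm,
    Complex.conj_re]

end IsTraceVector

theorem convexHull_subset_vonNeumannAlgebra {S : Set (K →L[ℂ] K)} (hS : S ⊆ N) :
    convexHull ℝ S ⊆ N :=
  convexHull_min hS (N.toStarSubalgebra.toSubalgebra.toSubmodule.restrictScalars ℝ).convex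

theorem exists_unique_norm_minimizer (hΩ : IsSeparatingVector N Ω) {S : Set (K →L[ℂ] K)}
    (hne : S.Nonempty) (hSN : S ⊆ N) {r : ℝ} (hr : ∀ a ∈ S, ‖a‖ ≤ r) :
    ∃ y ∈ N, y Ω ∈ closure (realEval Ω '' convexHull ℝ S) ∧
      ∀ w ∈ closure (realEval Ω '' convexHull ℝ S), ‖w‖ ≤ ‖y Ω‖ → w = y Ω := by
  let _ : InnerProductSpace ℝ K := InnerProductSpace.complexToReal
  obtain ⟨ζ, hζ, hmin⟩ := exists_forall_norm_le_imp_eq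
    (hne.convexHull.image (realEval Ω)).closure isClosed_closure.isComplete
    (((convex_convexHull ℝ S).linear_image (realEval Ω).toLinearMap).closure)
  have hball : convexHull ℝ S ⊆ Metric.closedBall 0 r :=
    convexHull_min (fun a ha => mem_closedBall_zero_iff.2 (hr a ha)) (convex_closedBall 0 r)
  obtain ⟨y, hy, rfl⟩ := hΩ.exists_mem_apply_eq_of_mem_closure
    (convexHull_subset_vonNeumannAlgebra hSN) (fun a ha => mem_closedBall_zero_iff.1 (hball ha)) hζ
  exact ⟨y, hy, hζ, hmin⟩

/-- Popa's convexity argument: the element of minimal 2-norm in the closed convex hull of the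
`ρ(g) σ(g)*` is fixed by `a ↦ ρ(g) a σ(g)*`. -/
theorem exists_intertwiner_of_le_re_inner (hsep : IsSeparatingVector N Ω)
    (htr : IsTraceVector N Ω) {G : Type*} [Monoid G] (ρ σ : G →* unitary (K →L[ℂ] K))
    (hρ : ∀ g, (ρ g : K →L[ℂ] K) ∈ N) (hσ : ∀ g, (σ g : K →L[ℂ] K) ∈ N) {c : ℝ} (hc : 0 < c)
    (h : ∀ g, c ≤ (⟪Ω, (ρ g * star (σ g) : K →L[ℂ] K) Ω⟫_ℂ).re) :
    ∃ y ∈ N, y ≠ 0 ∧ ∀ g, ρ g * y = y * σ g := by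
  let S : Set (K →L[ℂ] K) := Set.range fun g => (ρ g : K →L[ℂ] K) * star (σ g : K →L[ℂ] K)
  have hSN : S ⊆ N := by
    rintro _ ⟨g, rfl⟩
    exact mul_mem (hρ g) (star_mem (hσ g))
  have hnorm : ∀ a ∈ S, ‖a‖ ≤ 1 := by
    rintro _ ⟨g, rfl⟩
    refine ContinuousLinearMap.opNorm_le_bound _ zero_le_one fun η => ?_
    rw [one_mul]
    exact (ContinuousLinearMap.norm_map_of_mem_unitary (ρ g * star (σ g)).2 η).le
  have hinv : ∀ g, ∀ a ∈ S, ρ g * a * star (σ g : K →L[ℂ] K) ∈ S := by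
    rintro g _ ⟨k, rfl⟩
    exact ⟨g * k, by simp [mul_assoc]⟩
  obtain ⟨y, hy, hyS, hmin⟩ := exists_unique_norm_minimizer hsep (Set.range_nonempty _) hSN hnorm
  have hfix : ∀ g, ρ g * y * star (σ g : K →L[ℂ] K) = y := fun g => by
    refine hsep.eq_of_apply_eq (mul_mem (mul_mem (hρ g) hy) (star_mem (hσ g))) hy (hmin _ ?_ ?_)
    · exact htr.mul_mul_star_apply_mem_closure (convexHull_subset_vonNeumannAlgebra hSN)
        (ρ g).2 (σ g).2 (hσ g) (fun a => mul_mul_mem_convexHull (hinv g)) hy hyS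
    · exact (htr.norm_mul_mul_star_apply hy (ρ g).2 (σ g).2 (hσ g)).le
  refine ⟨y, hy, ?_, fun g => ?_⟩
  · rintro rfl
    have hcy := le_re_inner_of_mem_closure_convexHull (Set.forall_mem_range.2 h) hyS
    rw [zero_apply, inner_zero_right, Complex.zero_re] at hcy
    exact hc.not_ge hcy
  · rw [← congr($(hfix g) * (σ g : K →L[ℂ] K)), mul_assoc _ _ (σ g : K →L[ℂ] K),
      Unitary.coe_star_mul_self, mul_one]

instance isClosed_toStarSubalgebra (Q : VonNeumannAlgebra K) :
    IsClosed (Q.toStarSubalgebra : Set (K →L[ℂ] K)) := by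
  rw [VonNeumannAlgebra.coe_toStarSubalgebra, ← Q.centralizer_centralizer]
  exact Set.isClosed_centralizer _

theorem mul_eq_mul_of_forall_unitary {Q : VonNeumannAlgebra K}
    (α : Q.toStarSubalgebra →⋆ₐ[ℂ] K →L[ℂ] K) {y : K →L[ℂ] K}
    (h : ∀ u : unitary Q.toStarSubalgebra, α u * y = y * (u : Q.toStarSubalgebra))
    (x : Q.toStarSubalgebra) : α x * y = y * x := by
  have hx : x ∈ Submodule.span ℂ (unitary Q.toStarSubalgebra : Set Q.toStarSubalgebra) := by
    rw [CStarAlgebra.span_unitary]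
    exact Submodule.mem_top
  induction hx using Submodule.span_induction with
  | mem u hu => exact h ⟨u, hu⟩
  | zero => simp
  | add a a' _ _ ha ha' => simp [add_mul, mul_add, ha, ha']
  | smul k a _ ha => simp [ha]

theorem exists_partialIsometry_intertwiner (hsep : IsSeparatingVector N Ω)
    (htr : IsTraceVector N Ω) (hQN : Q ≤ N) (α : Q.toStarSubalgebra →⋆ₐ[ℂ] K →L[ℂ] K)
    (hα : ∀ x, α x ∈ N) {c : ℝ} (hc : 0 < c)
    (h : ∀ u : unitary Q.toStarSubalgebra,
      c ≤ (⟪Ω, (α u * star (u : K →L[ℂ] K)) Ω⟫_ℂ).re) :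
    ∃ v ∈ N, v ≠ 0 ∧ v * star v * v = v ∧ ∀ x : Q.toStarSubalgebra, α x * v = v * x := by
  obtain ⟨y, hyN, hy0, hyu⟩ := exists_intertwiner_of_le_re_inner hsep htr
    (Unitary.map (.ofClass α)).toMonoidHom
    (Unitary.map (.ofClass Q.toStarSubalgebra.subtype)).toMonoidHom
    (fun u => hα u) (fun u => hQN u.1.2) hc h
  obtain ⟨v, hv⟩ := exists_isPolarPart y
  have hy := mul_eq_mul_of_forall_unitary α hyu
  refine ⟨v, hv.mem hyN, hv.ne_zero hy0, hv.mul_star_mul, fun x => hv.mul_eq_mul (hy x) ?_⟩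
  rw [← map_star]
  exact hy (star x)

end Intertwiner

section CharacteristicFunctional

variable {Ω : Type*} [MeasurableSpace Ω] {P : Measure Ω}

theorem integral_norm_le_norm [IsProbabilityMeasure P] (f : Lp ℝ 2 P) : ∫ z, ‖f z‖ ∂P ≤ ‖f‖ := by
  rw [integral_norm_eq_lintegral_enorm (Lp.aestronglyMeasurable f), Lp.norm_def,
    ← eLpNorm_one_eq_lintegral_enorm]
  exact ENNReal.toReal_mono (Lp.eLpNorm_ne_top f)
    (eLpNorm_le_eLpNorm_of_exponent_le one_le_two (Lp.aestronglyMeasurable f))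

theorem integrable_exp_mul_I [IsFiniteMeasure P] {f : Ω → ℝ} (hf : AEStronglyMeasurable f P) :
    Integrable (fun z => Complex.exp (f z * Complex.I)) P :=
  .of_bound (Complex.continuous_exp.comp_aestronglyMeasurable
    ((Complex.continuous_ofReal.comp_aestronglyMeasurable hf).mul_const Complex.I)) 1
    (.of_forall fun _ => (Complex.norm_exp_ofReal_mul_I _).le)

theorem norm_exp_mul_I_sub_exp_mul_I_le (a b : ℝ) :
    ‖Complex.exp (a * Complex.I) - Complex.exp (b * Complex.I)‖ ≤ ‖a - b‖ := by
  have h : Complex.exp (a * Complex.I) - Complex.exp (b * Complex.I) =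
      Complex.exp (b * Complex.I) * (Complex.exp (Complex.I * ((a - b : ℝ) : ℂ)) - 1) := by
    rw [mul_sub, ← Complex.exp_add, mul_one]
    congr 2
    push_cast
    ring
  rw [h, norm_mul, Complex.norm_exp_ofReal_mul_I, one_mul]
  exact Real.norm_exp_I_mul_ofReal_sub_one_le

theorem continuous_integral_exp_mul_I [IsProbabilityMeasure P] :
    Continuous fun f : Lp ℝ 2 P => ∫ z, Complex.exp (f z * Complex.I) ∂P := by
  refine (LipschitzWith.of_dist_le_mul (K := 1) fun f g => ?_).continuous
  rw [dist_eq_norm, dist_eq_norm, NNReal.coe_one, one_mul,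
    ← integral_sub (integrable_exp_mul_I (Lp.aestronglyMeasurable f))
      (integrable_exp_mul_I (Lp.aestronglyMeasurable g))]
  refine (norm_integral_le_of_norm_le
    ((Lp.memLp (f - g)).integrable one_le_two).norm ?_).trans (integral_norm_le_norm _)
  filter_upwards [Lp.coeFn_sub f g] with z hz
  rw [hz]
  exact norm_exp_mul_I_sub_exp_mul_I_le _ _

end CharacteristicFunctional

section GaussianField

variable {ι κ H : Type*} [NormedAddCommGroup H] [InnerProductSpace ℝ H]

theorem map_const_mul_eval_gaussianProduct (i : ι) (c : ℝ) :
    (gaussianProduct ι).map (fun z => c * z i) = gaussianReal 0 (.mk (c ^ 2) (sq_nonneg c)) := by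
  have h : (gaussianProduct ι).map (Function.eval i) = gaussianReal 0 1 :=
    (measurePreserving_eval_infinitePi (fun _ : ι => gaussianReal 0 1) i).map_eq
  change (gaussianProduct ι).map ((c * ·) ∘ Function.eval i) = _
  rw [← Measure.map_map (by fun_prop) (by fun_prop), h, gaussianReal_map_const_mul]
  simp

theorem integral_exp_sum_coordinate (s : Finset ι) (c : ι → ℝ) :
    ∫ z, Complex.exp (((∑ i ∈ s, c i * z i : ℝ) : ℂ) * Complex.I) ∂gaussianProduct ι =
      Complex.exp ((-((∑ i ∈ s, c i ^ 2) / 2) : ℝ) : ℂ) := by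
  have hindep : iIndepFun (fun i (z : ι → ℝ) => c i * z i) (gaussianProduct ι) :=
    iIndepFun_infinitePi (X := fun i x => c i * x) (by fun_prop)
  have hmeas (i : ι) : Measurable fun z : ι → ℝ => c i * z i := by fun_prop
  have hprod := congrFun ((hindep.restrict s).charFun_map_fun_finsetSum_eq_prod
    fun i _ => (hmeas i).aemeasurable) 1
  rw [charFun_apply_real, integral_map (Measurable.aemeasurable (by fun_prop)) (by fun_prop)]
    at hprod
  simp only [Complex.ofReal_one, one_mul] at hprod
  simp only [hprod, Finset.prod_apply, map_const_mul_eval_gaussianProduct, charFun_gaussianReal,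
    ← Complex.exp_sum]
  congr 1
  push_cast
  rw [Finset.sum_div, ← Finset.sum_neg_distrib]
  simp

theorem gaussianField_basis_ae (e : HilbertBasis ι ℝ H) (i : ι) :
    gaussianField e (e i) =ᵐ[gaussianProduct ι] fun z => z i := by
  rw [gaussianField_basis]
  exact (memLp_coordinate i).coeFn_toLp

theorem gaussianField_sum_ae (e : HilbertBasis ι ℝ H) (s : Finset κ) (c : κ → ℝ) (f : κ → H) :
    gaussianField e (∑ k ∈ s, c k • f k) =ᵐ[gaussianProduct ι]
      fun z => ∑ k ∈ s, c k * gaussianField e (f k) z := by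
  have hsmul : ∀ᵐ z ∂gaussianProduct ι, ∀ k ∈ s,
      (c k • gaussianField e (f k) : Lp ℝ 2 _) z = c k * gaussianField e (f k) z :=
    (Filter.eventually_all_finset s).2 fun k _ => Lp.coeFn_smul (c k) _
  simp only [map_sum, map_smul]
  filter_upwards [Lp.coeFn_finsetSum s fun k => c k • gaussianField e (f k), hsmul] with z h1 h2
  rw [h1, Finset.sum_apply]
  exact Finset.sum_congr rfl h2

theorem norm_sum_smul_sq {f : κ → H} (hf : Orthonormal ℝ f) (s : Finset κ) (c : κ → ℝ) :
    ‖∑ k ∈ s, c k • f k‖ ^ 2 = ∑ k ∈ s, c k ^ 2 := by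
  rw [← real_inner_self_eq_norm_sq, hf.inner_sum]
  simp [sq]

theorem dense_span_range (e : HilbertBasis ι ℝ H) :
    Dense (Submodule.span ℝ (Set.range e) : Set H) :=
  Submodule.dense_iff_topologicalClosure_eq_top.2 e.dense_span

theorem integral_exp_gaussianField (e : HilbertBasis ι ℝ H) (ξ : H) :
    ∫ z, Complex.exp (gaussianField e ξ z * Complex.I) ∂gaussianProduct ι =
      Complex.exp ((-(‖ξ‖ ^ 2 / 2) : ℝ) : ℂ) := by
  have hclosed : IsClosed {ξ | ∫ z, Complex.exp (gaussianField e ξ z * Complex.I)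
      ∂gaussianProduct ι = Complex.exp ((-(‖ξ‖ ^ 2 / 2) : ℝ) : ℂ)} :=
    isClosed_eq (continuous_integral_exp_mul_I.comp (gaussianField e).continuous) (by fun_prop)
  refine (dense_span_range e).induction (fun ξ hξ => ?_) hclosed ξ
  obtain ⟨c, rfl⟩ := Finsupp.mem_span_range_iff_exists_finsupp.1 hξ
  have hcoord : ∀ᵐ z ∂gaussianProduct ι, ∀ i ∈ c.support, gaussianField e (e i) z = z i :=
    (Filter.eventually_all_finset c.support).2 fun i _ => gaussianField_basis_ae e i
  rw [Finsupp.sum, norm_sum_smul_sq e.orthonormal, ← integral_exp_sum_coordinate]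
  refine integral_congr_ae ?_
  filter_upwards [gaussianField_sum_ae e c.support c e, hcoord] with z hsum hz
  rw [hsum, Finset.sum_congr rfl fun i hi => by rw [hz i hi]]

theorem measurable_gaussianField_pi (e : HilbertBasis ι ℝ H) (f : κ → H) :
    Measurable fun (z : ι → ℝ) k => gaussianField e (f k) z :=
  measurable_pi_lambda _ fun _ => (Lp.stronglyMeasurable _).measurable

theorem map_gaussianField_eq_pi [Fintype κ] (e : HilbertBasis ι ℝ H) {f : κ → H}
    (hf : Orthonormal ℝ f) :
    (gaussianProduct ι).map (fun z k => gaussianField e (f k) z) =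
      Measure.pi fun _ : κ => gaussianReal 0 1 := by
  have hm := (measurable_gaussianField_pi e f).aemeasurable (μ := gaussianProduct ι)
  have := Measure.isProbabilityMeasure_map hm
  refine charFun_eq_pi_iff.1 fun t => ?_
  have hinner : ∀ᵐ z ∂gaussianProduct ι, ⟪WithLp.toLp 2 (fun k => gaussianField e (f k) z), t⟫_ℝ =
      gaussianField e (∑ k, t k • f k) z := by
    filter_upwards [gaussianField_sum_ae e Finset.univ t f] with z hz
    rw [hz, PiLp.inner_apply]
    simp
  calc charFun (((gaussianProduct ι).map fun z k => gaussianField e (f k) z).map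
        (WithLp.toLp 2)) t
      = ∫ z, Complex.exp (gaussianField e (∑ k, t k • f k) z * Complex.I) ∂gaussianProduct ι := by
        rw [charFun_apply, integral_map (by fun_prop) (by fun_prop),
          integral_map hm (by fun_prop)]
        refine integral_congr_ae ?_
        filter_upwards [hinner] with z hz
        rw [hz]
    _ = ∏ k, charFun (gaussianReal 0 1) (t k) := by
        simp only [integral_exp_gaussianField, norm_sum_smul_sq hf, charFun_gaussianReal,
          ← Complex.exp_sum]
        congr 1
        push_cast
        rw [Finset.sum_div, ← Finset.sum_neg_distrib]
        simp

theorem measurePreserving_gaussianField_pi (e : HilbertBasis ι ℝ H) {f : κ → H}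
    (hf : Orthonormal ℝ f) :
    MeasurePreserving (fun z k => gaussianField e (f k) z) (gaussianProduct ι)
      (gaussianProduct κ) := by
  refine ⟨measurable_gaussianField_pi e f, IsProjectiveLimit.unique (fun s => ?_)
    (Measure.isProjectiveLimit_infinitePi fun _ : κ => gaussianReal 0 1)⟩
  rw [Measure.map_map (Finset.measurable_restrict s) (measurable_gaussianField_pi e f)]
  exact map_gaussianField_eq_pi e (hf.comp _ Subtype.val_injective)

variable {H' : Type*} [NormedAddCommGroup H'] [InnerProductSpace ℝ H']

/-- The second quantisation of an isometry `T : H → H'`, realised as a point map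
`ℝ^κ → ℝ^ι` between the Gaussian spaces of `H'` and `H`: composition with it sends the Gaussian
variable of `ξ` to that of `T ξ`. -/
def gaussianMap (e : HilbertBasis ι ℝ H) (e' : HilbertBasis κ ℝ H') (T : H →ₗᵢ[ℝ] H')
    (z : κ → ℝ) (i : ι) : ℝ :=
  gaussianField e' (T (e i)) z

theorem measurePreserving_gaussianMap (e : HilbertBasis ι ℝ H) (e' : HilbertBasis κ ℝ H')
    (T : H →ₗᵢ[ℝ] H') :
    MeasurePreserving (gaussianMap e e' T) (gaussianProduct κ) (gaussianProduct ι) :=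
  measurePreserving_gaussianField_pi e' (e.orthonormal.comp_linearIsometry T)

theorem compMeasurePreserving_gaussianField (e : HilbertBasis ι ℝ H) (e' : HilbertBasis κ ℝ H')
    (T : H →ₗᵢ[ℝ] H') (ξ : H) :
    Lp.compMeasurePreserving _ (measurePreserving_gaussianMap e e' T) (gaussianField e ξ) =
      gaussianField e' (T ξ) := by
  have hmp := measurePreserving_gaussianMap e e' T
  suffices h : ((Lp.compMeasurePreservingₗᵢ ℝ _ hmp).comp (gaussianField e)).toContinuousLinearMap =
      ((gaussianField e').comp T).toContinuousLinearMap from congrArg (fun L => L ξ) h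
  refine ContinuousLinearMap.ext_on (dense_span_range e) ?_
  rintro _ ⟨i, rfl⟩
  refine Lp.ext ?_
  filter_upwards [Lp.coeFn_compMeasurePreserving (gaussianField e (e i)) hmp,
    hmp.quasiMeasurePreserving.ae (gaussianField_basis_ae e i)] with z h1 h2
  exact h1.trans h2

theorem compMeasurePreserving_omega (e : HilbertBasis ι ℝ H) (e' : HilbertBasis κ ℝ H')
    (T : H →ₗᵢ[ℝ] H') (ξ : H) :
    Lp.compMeasurePreserving _ (measurePreserving_gaussianMap e e' T) (omega e ξ) =
      omega e' (T ξ) := by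
  have hmp := measurePreserving_gaussianMap e e' T
  refine Lp.ext ?_
  filter_upwards [Lp.coeFn_compMeasurePreserving (omega e ξ) hmp,
    hmp.quasiMeasurePreserving.ae (coeFn_omega e ξ), coeFn_omega e' (T ξ),
    Lp.coeFn_compMeasurePreserving (gaussianField e ξ) hmp] with z h1 h2 h3 h4
  rw [h1, Function.comp_apply, h2, h3, omegaFun, omegaFun,
    ← compMeasurePreserving_gaussianField e e', h4, Function.comp_apply]

theorem integral_omega (e : HilbertBasis ι ℝ H) (ξ : H) :
    ∫ z, omega e ξ z ∂gaussianProduct ι = (Real.exp (-‖ξ‖ ^ 2) : ℂ) := by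
  have hnorm : ‖√2 • ξ‖ ^ 2 / 2 = ‖ξ‖ ^ 2 := by
    rw [norm_smul, mul_pow, Real.norm_of_nonneg (Real.sqrt_nonneg 2), Real.sq_sqrt zero_le_two]
    ring
  rw [Complex.ofReal_exp, ← hnorm, ← integral_exp_gaussianField e, map_smul]
  refine integral_congr_ae ?_
  filter_upwards [coeFn_omega e ξ, Lp.coeFn_smul √2 (gaussianField e ξ)] with z h1 h2
  rw [h1, h2, omegaFun]
  rfl

end GaussianField

section MultiplicationOperators

variable {Y Y' : Type*} [MeasurableSpace Y] [MeasurableSpace Y'] {m : Measure Y} {m' : Measure Y'}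

theorem star_mulOp (φ : Lp ℂ ∞ m) : star (mulOp φ) = mulOp (star φ) := by
  rw [ContinuousLinearMap.star_eq_adjoint, eq_comm, ContinuousLinearMap.eq_adjoint_iff]
  refine inner_mulOp_of_ae ?_
  filter_upwards [Lp.coeFn_star φ] with y hy
  rw [hy]
  exact (Complex.conj_conj _).symm

theorem norm_star_eq_norm {p : ℝ≥0∞} (f : Lp ℂ p m) : ‖star f‖ = ‖f‖ :=
  congrArg ENNReal.toReal AEEqFun.eLpNorm_star

section CompMeasurePreserving

variable {θ : Y' → Y} (hθ : MeasurePreserving θ m' m)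

theorem compMeasurePreserving_mulOp (φ : Lp ℂ ∞ m) (f : Lp ℂ 2 m) :
    Lp.compMeasurePreserving θ hθ (mulOp φ f) =
      mulOp (Lp.compMeasurePreserving θ hθ φ) (Lp.compMeasurePreserving θ hθ f) := by
  refine Lp.ext ?_
  filter_upwards [Lp.coeFn_compMeasurePreserving (mulOp φ f) hθ,
    Lp.coeFn_compMeasurePreserving φ hθ, Lp.coeFn_compMeasurePreserving f hθ,
    coeFn_mulOp (Lp.compMeasurePreserving θ hθ φ) (Lp.compMeasurePreserving θ hθ f),
    hθ.quasiMeasurePreserving.ae (coeFn_mulOp φ f)] with y h1 h2 h3 h4 h5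
  rw [h1, Function.comp_apply, h5, h4, h2, h3, Function.comp_apply, Function.comp_apply]

theorem compMeasurePreserving_star {p : ℝ≥0∞} (f : Lp ℂ p m) :
    Lp.compMeasurePreserving θ hθ (star f) = star (Lp.compMeasurePreserving θ hθ f) := by
  refine Lp.ext ?_
  filter_upwards [Lp.coeFn_compMeasurePreserving (star f) hθ,
    Lp.coeFn_compMeasurePreserving f hθ, Lp.coeFn_star (Lp.compMeasurePreserving θ hθ f),
    hθ.quasiMeasurePreserving.ae (Lp.coeFn_star f)] with y h1 h2 h3 h4
  rw [h1, Function.comp_apply, h4, h3, Pi.star_apply, Pi.star_apply, h2, Function.comp_apply]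

theorem compMeasurePreserving_const [IsFiniteMeasure m] [IsFiniteMeasure m'] {p : ℝ≥0∞} (c : ℂ) :
    Lp.compMeasurePreserving θ hθ (Lp.const p m c) = Lp.const p m' c :=
  rfl

end CompMeasurePreserving

variable [IsFiniteMeasure m]

theorem eq_of_forall_inner_mulOp_const {f g : Lp ℂ 2 m}
    (h : ∀ φ : Lp ℂ ∞ m, ⟪mulOp φ (Lp.const 2 m 1), f⟫_ℂ = ⟪mulOp φ (Lp.const 2 m 1), g⟫_ℂ) :
    f = g := by
  have hind {s : Set Y} (hs : MeasurableSet s) :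
      mulOp (indicatorConstLp ∞ hs (measure_ne_top m s) (1 : ℂ)) (Lp.const 2 m 1) =
        indicatorConstLp 2 hs (measure_ne_top m s) 1 := by
    refine Lp.ext ?_
    filter_upwards [coeFn_mulOp (indicatorConstLp ∞ hs (measure_ne_top m s) (1 : ℂ))
        (Lp.const 2 m 1), Lp.coeFn_const 2 m (1 : ℂ),
      indicatorConstLp_coeFn (p := ∞) (hs := hs) (hμs := measure_ne_top m s) (c := (1 : ℂ)),
      indicatorConstLp_coeFn (p := 2) (hs := hs) (hμs := measure_ne_top m s) (c := (1 : ℂ))]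
      with y h1 h2 h3 h4
    rw [h1, h2, h3, h4, Function.const_apply, mul_one]
  refine Lp.ext (Integrable.ae_eq_of_forall_setIntegral_eq _ _
    ((Lp.memLp f).integrable one_le_two) ((Lp.memLp g).integrable one_le_two) fun s hs _ => ?_)
  rw [← L2.inner_indicatorConstLp_one hs (measure_ne_top m s),
    ← L2.inner_indicatorConstLp_one hs (measure_ne_top m s), ← hind hs, h]

theorem inner_mulOp_const_star (φ : Lp ℂ ∞ m) (f : Lp ℂ 2 m) :
    ⟪mulOp φ (Lp.const 2 m 1), star f⟫_ℂ = ⟪mulOp φ f, Lp.const 2 m 1⟫_ℂ := by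
  rw [L2.inner_def, L2.inner_def]
  refine integral_congr_ae ?_
  filter_upwards [coeFn_mulOp φ (Lp.const 2 m 1), coeFn_mulOp φ f, Lp.coeFn_star f,
    Lp.coeFn_const 2 m (1 : ℂ)] with y h1 h2 h3 h4
  simp only [h1, h2, h3, h4, Function.const_apply, Pi.star_apply, RCLike.inner_apply, map_mul,
    mul_one, one_mul, RCLike.star_def]
  ring

end MultiplicationOperators

section Reindex

variable {κ κ' E : Type*} [NormedAddCommGroup E] [NormedSpace ℂ E]

/-- Composition with a bijection `σ` of the index sets, as an isometry of `ℓ²`-spaces. -/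
def reindex (σ : κ ≃ κ') : lp (fun _ : κ' => E) 2 →ₗᵢ[ℂ] lp (fun _ : κ => E) 2 where
  toFun f := ⟨fun k => f (σ k),
    memℓp_gen (σ.summable_iff.2 ((lp.memℓp f).summable (by norm_num)))⟩
  map_add' _ _ := rfl
  map_smul' _ _ := rfl
  norm_map' f := by
    rw [lp.norm_eq_tsum_rpow (by norm_num), lp.norm_eq_tsum_rpow (by norm_num)]
    exact congrArg (· ^ _) (σ.tsum_eq fun k => ‖f k‖ ^ (2 : ℝ≥0∞).toReal)

end Reindex

section GeneratedCommutant

variable {K : Type*} [NormedAddCommGroup K] [InnerProductSpace ℂ K] [CompleteSpace K]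

theorem mem_commutant_vnGenerated {S : Set (K →L[ℂ] K)} (hS : ∀ s ∈ S, star s ∈ S)
    {z : K →L[ℂ] K} (hz : ∀ s ∈ S, Commute s z) : z ∈ (vnGenerated S).commutant := by
  rw [vnGenerated, VonNeumannAlgebra.commutant_commutant, mem_commutantOf]
  exact fun s hs => ⟨hz s hs, hz _ (hS s hs)⟩

end GeneratedCommutant

section CrossedProduct

variable {Γ ι H X : Type*} [NormedAddCommGroup H] [InnerProductSpace ℝ H] [MeasurableSpace X]
variable (μ : Measure X)

theorem star_diagOp {φ ψ : Γ → Lp ℂ ∞ ((gaussianProduct ι).prod μ)} {C D : ℝ} (hC : 0 ≤ C)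
    (hφ : ∀ g, ‖φ g‖ ≤ C) (hD : 0 ≤ D) (hψ : ∀ g, ‖ψ g‖ ≤ D) (h : ∀ g, ψ g = star (φ g)) :
    star (diagOp μ φ hC hφ) = diagOp μ ψ hD hψ := by
  rw [ContinuousLinearMap.star_eq_adjoint, eq_comm, ContinuousLinearMap.eq_adjoint_iff]
  intro f f'
  rw [lp.inner_eq_tsum, lp.inner_eq_tsum]
  refine tsum_congr fun g => ?_
  rw [diagOp_apply, diagOp_apply, h, ← star_mulOp, ContinuousLinearMap.star_eq_adjoint,
    ContinuousLinearMap.adjoint_inner_left]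

theorem commute_diagOp {φ ψ : Γ → Lp ℂ ∞ ((gaussianProduct ι).prod μ)} {C D : ℝ} (hC : 0 ≤ C)
    (hφ : ∀ g, ‖φ g‖ ≤ C) (hD : 0 ≤ D) (hψ : ∀ g, ‖ψ g‖ ≤ D) :
    Commute (diagOp μ φ hC hφ) (diagOp μ ψ hD hψ) := by
  ext1 f
  exact lp.ext (funext fun g => mulOp_comm _ _ _)

/-- Right multiplication by `φ ∈ L^∞(Z × X)`. -/
def rightMul (Γ : Type*) (φ : Lp ℂ ∞ ((gaussianProduct ι).prod μ)) : Op Γ ι μ :=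
  diagOp μ (fun _ => φ) (norm_nonneg φ) fun _ => le_rfl

open Classical in
theorem rightMul_single (φ : Lp ℂ ∞ ((gaussianProduct ι).prod μ)) (h : Γ)
    (f : Lp ℂ 2 ((gaussianProduct ι).prod μ)) :
    rightMul μ Γ φ (lp.single 2 h f) = lp.single 2 h (mulOp φ f) := by
  refine lp.ext (funext fun g => ?_)
  rw [rightMul, diagOp_apply]
  by_cases hg : g = h
  · subst hg
    rw [lp.single_apply_self, lp.single_apply_self]
  · rw [lp.single_apply_ne _ _ _ hg, lp.single_apply_ne _ _ _ hg, map_zero]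

variable [Group Γ]

theorem translate_translate [MulAction Γ X] [MeasurableConstSMul Γ X] [SMulInvariantMeasure Γ X μ]
    (g h : Γ) (a : Lp ℂ ∞ μ) : translate μ g (translate μ h a) = translate μ (g * h) a := by
  rw [translate, translate, translate, ← Lp.compMeasurePreserving_comp_apply]
  congr 2
  ext x
  simp [mul_smul]

theorem star_groupUnitary (h : Γ) : star (groupUnitary μ ι h) = groupUnitary μ ι h⁻¹ := by
  rw [ContinuousLinearMap.star_eq_adjoint, eq_comm, ContinuousLinearMap.eq_adjoint_iff]
  intro f f'
  rw [lp.inner_eq_tsum, lp.inner_eq_tsum]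
  simp only [groupUnitary_apply, inv_inv]
  rw [← (Equiv.mulLeft h).tsum_eq (fun g => ⟪f g, f' (h⁻¹ * g)⟫_ℂ)]
  simp

variable [IsProbabilityMeasure μ]

theorem traceVector_one : traceVector Γ ι μ 1 = Lp.const 2 _ (1 : ℂ) := by
  classical exact lp.single_apply_self _ _ _

theorem traceVector_of_ne {g : Γ} (hg : g ≠ 1) : traceVector Γ ι μ g = 0 := by
  classical exact lp.single_apply_ne _ _ _ hg

theorem star_omegaOp (e : HilbertBasis ι ℝ H) (π : Γ →* (H ≃ₗᵢ[ℝ] H)) (ξ : H) :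
    star (omegaOp μ e π ξ) = omegaOp μ e π (-ξ) := by
  refine star_diagOp μ _ _ _ _ fun g => Lp.ext ?_
  rw [map_neg]
  exact (omegaTensorOne_neg μ e _).trans (Lp.coeFn_star _).symm

variable [MulAction Γ X] [MeasurableConstSMul Γ X] [SMulInvariantMeasure Γ X μ]

theorem star_functionOp (a : Lp ℂ ∞ μ) :
    star (functionOp μ Γ ι a) = functionOp μ Γ ι (star a) :=
  star_diagOp μ _ _ _ _ fun _ => by
    rw [translate, compMeasurePreserving_star, oneTensor, compMeasurePreserving_star]
    rfl

theorem mem_commutant_smallAlgebra {z : Op Γ ι μ} (ha : ∀ a, Commute (functionOp μ Γ ι a) z)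
    (hu : ∀ h, Commute (groupUnitary μ ι h) z) : z ∈ (smallAlgebra μ Γ ι).commutant := by
  refine mem_commutant_vnGenerated ?_ ?_
  · rintro _ (⟨a, rfl⟩ | ⟨h, rfl⟩)
    · exact .inl ⟨star a, (star_functionOp μ a).symm⟩
    · exact .inr ⟨h⁻¹, (star_groupUnitary μ h).symm⟩
  · rintro _ (⟨a, rfl⟩ | ⟨h, rfl⟩)
    exacts [ha a, hu h]

variable (e : HilbertBasis ι ℝ H) (π : Γ →* (H ≃ₗᵢ[ℝ] H))

theorem mem_commutant_baseAlgebra {z : Op Γ ι μ} (hω : ∀ ξ, Commute (omegaOp μ e π ξ) z)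
    (ha : ∀ a, Commute (functionOp μ Γ ι a) z) : z ∈ (baseAlgebra μ e π).commutant := by
  refine mem_commutant_vnGenerated ?_ ?_
  · rintro _ (⟨ξ, rfl⟩ | ⟨a, rfl⟩)
    · exact .inl ⟨-ξ, (star_omegaOp μ e π ξ).symm⟩
    · exact .inr ⟨star a, (star_functionOp μ a).symm⟩
  · rintro _ (⟨ξ, rfl⟩ | ⟨a, rfl⟩)
    exacts [hω ξ, ha a]

theorem mem_commutant_bigAlgebra {z : Op Γ ι μ} (hω : ∀ ξ, Commute (omegaOp μ e π ξ) z)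
    (ha : ∀ a, Commute (functionOp μ Γ ι a) z) (hu : ∀ h, Commute (groupUnitary μ ι h) z) :
    z ∈ (bigAlgebra μ e π).commutant := by
  refine mem_commutant_vnGenerated ?_ ?_
  · rintro _ (hx | ⟨h, rfl⟩)
    · exact .inl (star_mem (S := VonNeumannAlgebra (Space Γ ι μ)) hx)
    · exact .inr ⟨h⁻¹, (star_groupUnitary μ h).symm⟩
  · rintro x (hx | ⟨h, rfl⟩)
    · exact VonNeumannAlgebra.mem_commutant_iff.1 (mem_commutant_baseAlgebra μ e π hω ha) x hx
    · exact hu h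

theorem rightMul_mem_commutant (φ : Lp ℂ ∞ ((gaussianProduct ι).prod μ)) :
    rightMul μ Γ φ ∈ (bigAlgebra μ e π).commutant := by
  refine mem_commutant_bigAlgebra μ e π (fun _ => commute_diagOp μ _ _ _ _)
    (fun _ => commute_diagOp μ _ _ _ _) fun h => ?_
  ext1 f
  refine lp.ext (funext fun g => ?_)
  change mulOp φ (f (h⁻¹ * g)) = mulOp φ (f (h⁻¹ * g))
  rfl

theorem measurePreserving_diagonalAction (h : Γ) :
    MeasurePreserving (Prod.map (gaussianMap e e (π h).toLinearIsometry) fun x : X => h⁻¹ • x)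
      ((gaussianProduct ι).prod μ) ((gaussianProduct ι).prod μ) :=
  (measurePreserving_gaussianMap e e _).prod (measurePreserving_smul h⁻¹ μ)

/-- The Koopman representation of the diagonal action of `Γ` on `L²(Z × X)`. -/
def koopman (h : Γ) :
    Lp ℂ 2 ((gaussianProduct ι).prod μ) →ₗᵢ[ℂ] Lp ℂ 2 ((gaussianProduct ι).prod μ) :=
  Lp.compMeasurePreservingₗᵢ ℂ _ (measurePreserving_diagonalAction μ e π h)

theorem koopman_mulOp_omegaTensorOne (h : Γ) (ξ : H) (f : Lp ℂ 2 ((gaussianProduct ι).prod μ)) :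
    koopman μ e π h (mulOp (omegaTensorOne μ e ξ) f) =
      mulOp (omegaTensorOne μ e (π h ξ)) (koopman μ e π h f) := by
  refine (compMeasurePreserving_mulOp (measurePreserving_diagonalAction μ e π h) _ f).trans ?_
  congr 2
  rw [omegaTensorOne, omegaTensorOne, ← Lp.compMeasurePreserving_comp_apply]
  change _ = Lp.compMeasurePreserving _ _ (omega e ((π h).toLinearIsometry ξ))
  rw [← compMeasurePreserving_omega e e, ← Lp.compMeasurePreserving_comp_apply]
  rfl

theorem koopman_mulOp_oneTensor (h : Γ) (a : Lp ℂ ∞ μ)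
    (f : Lp ℂ 2 ((gaussianProduct ι).prod μ)) :
    koopman μ e π h (mulOp (oneTensor μ ι a) f) =
      mulOp (oneTensor μ ι (translate μ h a)) (koopman μ e π h f) := by
  refine (compMeasurePreserving_mulOp (measurePreserving_diagonalAction μ e π h) _ f).trans ?_
  congr 2
  rw [oneTensor, oneTensor, translate, ← Lp.compMeasurePreserving_comp_apply,
    ← Lp.compMeasurePreserving_comp_apply]
  rfl

theorem koopman_const (h : Γ) (c : ℂ) :
    koopman μ e π h (Lp.const 2 _ c) = Lp.const 2 _ c :=
  compMeasurePreserving_const (measurePreserving_diagonalAction μ e π h) c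

/-- Right multiplication by the canonical unitary `u_h*`: since `f ∈ ℓ²(Γ, L²(Z × X))` has the
coefficient `σ_g(f(g))` at `u_g`, it is `(r_h f)(g) = σ_h(f(g h))`. -/
def rightShift (h : Γ) : Op Γ ι μ :=
  lp.mapCLM 2 (fun _ => (koopman μ e π h).toContinuousLinearMap) zero_le_one
    (fun _ => LinearIsometry.norm_toContinuousLinearMap_le _) ∘L
  (reindex (Equiv.mulRight h)).toContinuousLinearMap

theorem rightShift_apply (h : Γ) (f : Space Γ ι μ) (g : Γ) :
    rightShift μ e π h f g = koopman μ e π h (f (g * h)) := rfl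

theorem rightShift_mem_commutant (h : Γ) :
    rightShift μ e π h ∈ (bigAlgebra μ e π).commutant := by
  refine mem_commutant_bigAlgebra μ e π (fun ξ => ?_) (fun a => ?_) (fun k => ?_) <;> ext1 f <;>
    refine lp.ext (funext fun g => ?_)
  · change mulOp (omegaTensorOne μ e (π g⁻¹ ξ)) (koopman μ e π h (f (g * h))) =
      koopman μ e π h (mulOp (omegaTensorOne μ e (π (g * h)⁻¹ ξ)) (f (g * h)))
    have hξ : π h (π (g * h)⁻¹ ξ) = π g⁻¹ ξ := by
      change (π h * π (g * h)⁻¹) ξ = _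
      rw [← map_mul, mul_inv_rev, mul_inv_cancel_left]
    rw [koopman_mulOp_omegaTensorOne, hξ]
  · change mulOp (oneTensor μ ι (translate μ g⁻¹ a)) (koopman μ e π h (f (g * h))) =
      koopman μ e π h (mulOp (oneTensor μ ι (translate μ (g * h)⁻¹ a)) (f (g * h)))
    rw [koopman_mulOp_oneTensor, translate_translate, mul_inv_rev, mul_inv_cancel_left]
  · change koopman μ e π h (f (k⁻¹ * g * h)) = koopman μ e π h (f (k⁻¹ * (g * h)))
    rw [mul_assoc]

open Classical in
theorem rightShift_traceVector (h : Γ) :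
    rightShift μ e π h⁻¹ (traceVector Γ ι μ) = lp.single 2 h (Lp.const 2 _ (1 : ℂ)) := by
  refine lp.ext (funext fun g => ?_)
  rw [rightShift_apply]
  by_cases hg : g = h
  · subst hg
    rw [mul_inv_cancel, traceVector_one, koopman_const, lp.single_apply_self]
  · rw [traceVector_of_ne μ (mul_inv_eq_one.not.2 hg), map_zero, lp.single_apply_ne _ _ _ hg]

open Classical in
theorem rightMul_rightShift_traceVector (φ : Lp ℂ ∞ ((gaussianProduct ι).prod μ)) (h : Γ) :
    rightMul μ Γ φ (rightShift μ e π h⁻¹ (traceVector Γ ι μ)) =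
      lp.single 2 h (mulOp φ (Lp.const 2 _ (1 : ℂ))) := by
  rw [rightShift_traceVector, rightMul_single]

theorem isSeparatingVector_traceVector :
    IsSeparatingVector (bigAlgebra μ e π) (traceVector Γ ι μ) := by
  classical
  let S : Submodule ℂ (Space Γ ι μ) :=
    (bigAlgebra μ e π).commutant.toStarSubalgebra.toSubalgebra.toSubmodule.map
      (ContinuousLinearMap.apply ℂ (Space Γ ι μ) (traceVector Γ ι μ)).toLinearMap
  change Dense (S : Set (Space Γ ι μ))
  rw [Submodule.dense_iff_topologicalClosure_eq_top, Submodule.topologicalClosure_eq_top_iff,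
    Submodule.eq_bot_iff]
  intro f hf
  refine lp.ext (funext fun h => eq_of_forall_inner_mulOp_const fun φ => ?_)
  have hz : rightMul μ Γ φ * rightShift μ e π h⁻¹ ∈ (bigAlgebra μ e π).commutant :=
    mul_mem (rightMul_mem_commutant μ e π φ) (rightShift_mem_commutant μ e π h⁻¹)
  have horth := (Submodule.mem_orthogonal _ _).1 hf _ ⟨_, hz, rfl⟩
  change ⟪rightMul μ Γ φ (rightShift μ e π h⁻¹ (traceVector Γ ι μ)), f⟫_ℂ = 0 at horth
  rw [rightMul_rightShift_traceVector, lp.inner_single_left] at horth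
  rw [horth, lp.coeFn_zero, Pi.zero_apply, inner_zero_right]

/-- The modular conjugation of `M̃`, computed on Fourier coefficients. -/
theorem star_apply_traceVector_apply {a : Op Γ ι μ} (ha : a ∈ bigAlgebra μ e π) (g : Γ) :
    star a (traceVector Γ ι μ) g = star (koopman μ e π g⁻¹ (a (traceVector Γ ι μ) g⁻¹)) := by
  classical
  set Ω := traceVector Γ ι μ
  refine eq_of_forall_inner_mulOp_const fun φ => ?_
  calc ⟪mulOp φ (Lp.const 2 _ 1), star a Ω g⟫_ℂ
      = ⟪a (rightMul μ Γ φ (rightShift μ e π g⁻¹ Ω)), Ω⟫_ℂ := by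
        rw [rightMul_rightShift_traceVector, ← ContinuousLinearMap.adjoint_inner_right a,
          lp.inner_single_left, ContinuousLinearMap.star_eq_adjoint]
    _ = ⟪rightMul μ Γ φ (rightShift μ e π g⁻¹ (a Ω)), Ω⟫_ℂ := by
        rw [apply_apply_of_mem_commutant (rightShift_mem_commutant μ e π g⁻¹) ha,
          apply_apply_of_mem_commutant (rightMul_mem_commutant μ e π φ) ha]
    _ = ⟪mulOp φ (koopman μ e π g⁻¹ (a Ω g⁻¹)), Lp.const 2 _ 1⟫_ℂ := by
        have hg := rightShift_apply μ e π g⁻¹ (a Ω) 1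
        rw [one_mul] at hg
        rw [← hg]
        exact lp.inner_single_right 1 _ _
    _ = ⟪mulOp φ (Lp.const 2 _ 1), star (koopman μ e π g⁻¹ (a Ω g⁻¹))⟫_ℂ :=
        (inner_mulOp_const_star φ _).symm

theorem isTraceVector_traceVector : IsTraceVector (bigAlgebra μ e π) (traceVector Γ ι μ) := by
  intro a ha
  rw [lp.norm_eq_tsum_rpow (by norm_num), lp.norm_eq_tsum_rpow (by norm_num),
    ← (Equiv.inv Γ).tsum_eq fun g => ‖a (traceVector Γ ι μ) g‖ ^ _]
  simp only [star_apply_traceVector_apply μ e π ha, norm_star_eq_norm, LinearIsometry.norm_map,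
    Equiv.inv_apply]

end CrossedProduct

theorem norm_sq_le_re_inner_of_apply_eq_smul {κ E : Type*} [NormedAddCommGroup E]
    [InnerProductSpace ℂ E] {f f' : lp (fun _ : κ => E) 2} {c : κ → ℝ} (hc0 : ∀ k, 0 ≤ c k)
    (hc1 : ∀ k, c k ≤ 1) (h : ∀ k, f' k = (c k : ℂ) • f k) : ‖f'‖ ^ 2 ≤ (⟪f, f'⟫_ℂ).re := by
  rw [← inner_self_eq_norm_sq (𝕜 := ℂ)]
  refine hasSum_le (fun k => ?_) (Complex.hasSum_re (lp.hasSum_inner f' f'))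
    (Complex.hasSum_re (lp.hasSum_inner f f'))
  have hnonneg : 0 ≤ (⟪f k, f' k⟫_ℂ).re := by
    rw [h, inner_smul_right, Complex.re_ofReal_mul]
    exact mul_nonneg (hc0 k) (inner_self_nonneg (𝕜 := ℂ))
  calc (⟪f' k, f' k⟫_ℂ).re = c k * (⟪f k, f' k⟫_ℂ).re := by
        rw [h, inner_smul_left, Complex.conj_ofReal, Complex.re_ofReal_mul]
    _ ≤ (⟪f k, f' k⟫_ℂ).re := mul_le_of_le_one_left hnonneg (hc1 k)

section FunctionsOnX

variable {ι H X : Type*} [NormedAddCommGroup H] [InnerProductSpace ℝ H] [MeasurableSpace X]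
variable (μ : Measure X) [IsProbabilityMeasure μ]

/-- The embedding `p ↦ 1 ⊗ p` of `L²(X)` into `L²(Z × X)`. -/
def sndEmbedding (ι : Type*) : Lp ℂ 2 μ →ₗᵢ[ℂ] Lp ℂ 2 ((gaussianProduct ι).prod μ) :=
  Lp.compMeasurePreservingₗᵢ ℂ Prod.snd measurePreserving_snd

theorem sndEmbedding_mulOp (a : Lp ℂ ∞ μ) (p : Lp ℂ 2 μ) :
    sndEmbedding μ ι (mulOp a p) = mulOp (oneTensor μ ι a) (sndEmbedding μ ι p) :=
  compMeasurePreserving_mulOp measurePreserving_snd a p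

/-- The adjoint of `sndEmbedding`, which integrates out the Gaussian variable. -/
def sndAdjoint (ι : Type*) : Lp ℂ 2 ((gaussianProduct ι).prod μ) →L[ℂ] Lp ℂ 2 μ :=
  ContinuousLinearMap.adjoint (sndEmbedding μ ι).toContinuousLinearMap

theorem inner_sndAdjoint (p : Lp ℂ 2 μ) (f : Lp ℂ 2 ((gaussianProduct ι).prod μ)) :
    ⟪p, sndAdjoint μ ι f⟫_ℂ = ⟪sndEmbedding μ ι p, f⟫_ℂ :=
  ContinuousLinearMap.adjoint_inner_right _ _ _

theorem sndAdjoint_sndEmbedding (p : Lp ℂ 2 μ) : sndAdjoint μ ι (sndEmbedding μ ι p) = p :=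
  ext_inner_left ℂ fun q => by rw [inner_sndAdjoint, LinearIsometry.inner_map_map]

theorem sndAdjoint_mulOp_oneTensor (a : Lp ℂ ∞ μ) (f : Lp ℂ 2 ((gaussianProduct ι).prod μ)) :
    sndAdjoint μ ι (mulOp (oneTensor μ ι a) f) = mulOp a (sndAdjoint μ ι f) := by
  have hstar : star (oneTensor μ ι a) = oneTensor μ ι (star a) :=
    (compMeasurePreserving_star measurePreserving_snd a).symm
  refine ext_inner_left ℂ fun p => ?_
  rw [inner_sndAdjoint, ← ContinuousLinearMap.adjoint_inner_left,
    ← ContinuousLinearMap.adjoint_inner_left, ← ContinuousLinearMap.star_eq_adjoint,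
    ← ContinuousLinearMap.star_eq_adjoint, star_mulOp, star_mulOp, inner_sndAdjoint,
    sndEmbedding_mulOp, hstar]

theorem sndAdjoint_mulOp_omegaTensorOne (e : HilbertBasis ι ℝ H) (ξ : H) (q : Lp ℂ 2 μ) :
    sndAdjoint μ ι (mulOp (omegaTensorOne μ e ξ) (sndEmbedding μ ι q)) =
      (Real.exp (-‖ξ‖ ^ 2) : ℂ) • q := by
  refine ext_inner_left ℂ fun p => ?_
  rw [inner_sndAdjoint, inner_smul_right, L2.inner_def, L2.inner_def, ← integral_omega e ξ,
    ← integral_prod_mul]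
  refine integral_congr_ae ?_
  filter_upwards [coeFn_mulOp (omegaTensorOne μ e ξ) (sndEmbedding μ ι q),
    Lp.coeFn_compMeasurePreserving p (measurePreserving_snd (μ := gaussianProduct ι)),
    Lp.coeFn_compMeasurePreserving q (measurePreserving_snd (μ := gaussianProduct ι)),
    coeFn_omegaTensorOne μ e ξ] with y hmul hp hq hω
  change sndEmbedding μ ι p y = p y.2 at hp
  change sndEmbedding μ ι q y = q y.2 at hq
  rw [hmul, hp, hq, hω, RCLike.inner_apply, RCLike.inner_apply, mul_assoc]

/-- The projection of `ℓ²(Γ, L²(Z × X))` onto `ℓ²(Γ, 1 ⊗ L²(X))`. -/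
def fibreProjection (Γ ι : Type*) : Op Γ ι μ :=
  lp.mapCLM 2 (fun _ : Γ => (sndEmbedding μ ι).toContinuousLinearMap ∘L sndAdjoint μ ι)
    zero_le_one fun _ => by
      rw [LinearIsometry.norm_toContinuousLinearMap_comp, sndAdjoint, LinearIsometryEquiv.norm_map]
      exact LinearIsometry.norm_toContinuousLinearMap_le _

variable {Γ : Type*}

theorem fibreProjection_apply (f : Space Γ ι μ) (g : Γ) :
    fibreProjection μ Γ ι f g = sndEmbedding μ ι (sndAdjoint μ ι (f g)) := rfl

theorem inner_fibreProjection_left (f f' : Space Γ ι μ) :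
    ⟪fibreProjection μ Γ ι f, f'⟫_ℂ = ⟪f, fibreProjection μ Γ ι f'⟫_ℂ := by
  rw [lp.inner_eq_tsum, lp.inner_eq_tsum]
  refine tsum_congr fun g => ?_
  rw [fibreProjection_apply, fibreProjection_apply, ← inner_sndAdjoint, ← inner_conj_symm (f g),
    ← inner_sndAdjoint, inner_conj_symm]

variable [Group Γ]

theorem fibreProjection_traceVector :
    fibreProjection μ Γ ι (traceVector Γ ι μ) = traceVector Γ ι μ := by
  refine lp.ext (funext fun g => ?_)
  rw [fibreProjection_apply]
  by_cases hg : g = 1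
  · have hconst : Lp.const 2 _ (1 : ℂ) = sndEmbedding μ ι (Lp.const 2 μ 1) := rfl
    rw [hg, traceVector_one, hconst, sndAdjoint_sndEmbedding]
  · rw [traceVector_of_ne μ hg, map_zero, map_zero]

variable [MulAction Γ X] [MeasurableConstSMul Γ X] [SMulInvariantMeasure Γ X μ]

theorem fibreProjection_mem_commutant :
    fibreProjection μ Γ ι ∈ (smallAlgebra μ Γ ι).commutant := by
  refine mem_commutant_smallAlgebra μ (fun a => ?_) (fun h => ?_) <;> ext1 f <;>
    refine lp.ext (funext fun g => ?_)
  · change mulOp (oneTensor μ ι (translate μ g⁻¹ a)) (sndEmbedding μ ι (sndAdjoint μ ι (f g))) =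
      sndEmbedding μ ι (sndAdjoint μ ι (mulOp (oneTensor μ ι (translate μ g⁻¹ a)) (f g)))
    rw [sndAdjoint_mulOp_oneTensor, sndEmbedding_mulOp]
  · change sndEmbedding μ ι (sndAdjoint μ ι (f (h⁻¹ * g))) =
      sndEmbedding μ ι (sndAdjoint μ ι (f (h⁻¹ * g)))
    rfl

theorem fibreProjection_apply_traceVector {x : Op Γ ι μ} (hx : x ∈ smallAlgebra μ Γ ι) :
    fibreProjection μ Γ ι (x (traceVector Γ ι μ)) = x (traceVector Γ ι μ) := by
  rw [apply_apply_of_mem_commutant (fibreProjection_mem_commutant μ) hx,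
    fibreProjection_traceVector]

end FunctionsOnX

section Estimate

variable {Γ ι H X : Type*} [NormedAddCommGroup H] [InnerProductSpace ℝ H] [MeasurableSpace X]
variable (μ : Measure X) [IsProbabilityMeasure μ] [Group Γ]

theorem trace_star_mul (x y : Op Γ ι μ) :
    trace (star x * y) = ⟪x (traceVector Γ ι μ), y (traceVector Γ ι μ)⟫_ℂ := by
  rw [trace, mul_apply_eq_comp, ContinuousLinearMap.star_eq_adjoint,
    ContinuousLinearMap.adjoint_inner_right]

theorem norm2_eq_norm_apply (x : Op Γ ι μ) : norm2 x = ‖x (traceVector Γ ι μ)‖ := by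
  rw [norm2, trace_star_mul, norm_eq_sqrt_re_inner (𝕜 := ℂ)]
  rfl

theorem deformationOp_traceVector (e : HilbertBasis ι ℝ H) {b : Γ → H} (hb : b 1 = 0) (t : ℝ) :
    deformationOp μ e b t (traceVector Γ ι μ) = traceVector Γ ι μ := by
  refine lp.ext (funext fun g => ?_)
  rw [deformationOp, diagOp_apply]
  by_cases hg : g = 1
  · rw [hg, inv_one, hb, smul_zero, neg_zero, mulOp_eq_self (omegaTensorOne_zero μ e)]
  · rw [traceVector_of_ne μ hg, map_zero]

theorem deformation_apply_traceVector_apply (e : HilbertBasis ι ℝ H) {b : Γ → H} (hb : b 1 = 0)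
    (t : ℝ) (x : Op Γ ι μ) (g : Γ) :
    deformation μ e b t x (traceVector Γ ι μ) g =
      mulOp (omegaTensorOne μ e (-(t • b g⁻¹))) (x (traceVector Γ ι μ) g) := by
  rw [deformation_apply, mul_apply_eq_comp, mul_apply_eq_comp, deformationOp_traceVector μ e hb,
    deformationOp, diagOp_apply]

variable [MulAction Γ X] [MeasurableConstSMul Γ X] [SMulInvariantMeasure Γ X μ]

theorem norm2_condExp_le (a : Op Γ ι μ) :
    norm2 (condExp (smallAlgebra μ Γ ι) a) ≤
      ‖fibreProjection μ Γ ι (a (traceVector Γ ι μ))‖ := by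
  set Ω := traceVector Γ ι μ
  rw [norm2_eq_norm_apply, condExp]
  split_ifs with hex
  · obtain ⟨hyM, hy⟩ := hex.choose_spec
    set y := hex.choose
    have horth : ⟪y Ω, y Ω⟫_ℂ = ⟪y Ω, fibreProjection μ Γ ι (a Ω)⟫_ℂ := by
      rw [← inner_fibreProjection_left, fibreProjection_apply_traceVector μ hyM,
        ← trace_star_mul, ← trace_star_mul, hy _ (star_mem hyM)]
    have hcauchy := norm_inner_le_norm (𝕜 := ℂ) (y Ω) (fibreProjection μ Γ ι (a Ω))
    rw [← horth, inner_self_eq_norm_sq_to_K, norm_pow, RCLike.norm_ofReal, sq_abs] at hcauchy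
    nlinarith [norm_nonneg (y Ω), norm_nonneg (fibreProjection μ Γ ι (a Ω))]
  · rw [zero_apply, norm_zero]
    exact norm_nonneg _

/-- `E_M(α_t(u_g)) = exp(-‖t b(g)‖²) u_g`. -/
theorem fibreProjection_deformation_traceVector (e : HilbertBasis ι ℝ H) {b : Γ → H}
    (hb : b 1 = 0) (t : ℝ) {x : Op Γ ι μ} (hx : x ∈ smallAlgebra μ Γ ι) (g : Γ) :
    fibreProjection μ Γ ι (deformation μ e b t x (traceVector Γ ι μ)) g =
      (Real.exp (-‖-(t • b g⁻¹)‖ ^ 2) : ℂ) • x (traceVector Γ ι μ) g := by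
  have hxg : x (traceVector Γ ι μ) g =
      sndEmbedding μ ι (sndAdjoint μ ι (x (traceVector Γ ι μ) g)) := by
    rw [← fibreProjection_apply, fibreProjection_apply_traceVector μ hx]
  rw [fibreProjection_apply, deformation_apply_traceVector_apply μ e hb, hxg,
    sndAdjoint_mulOp_omegaTensorOne, map_smul]

theorem norm2_condExp_deformation_sq_le (e : HilbertBasis ι ℝ H) {b : Γ → H} (hb : b 1 = 0)
    (t : ℝ) {x : Op Γ ι μ} (hx : x ∈ smallAlgebra μ Γ ι) :
    norm2 (condExp (smallAlgebra μ Γ ι) (deformation μ e b t x)) ^ 2 ≤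
      (⟪x (traceVector Γ ι μ), deformation μ e b t x (traceVector Γ ι μ)⟫_ℂ).re := by
  calc norm2 (condExp (smallAlgebra μ Γ ι) (deformation μ e b t x)) ^ 2
      ≤ ‖fibreProjection μ Γ ι (deformation μ e b t x (traceVector Γ ι μ))‖ ^ 2 :=
        pow_le_pow_left₀ (Real.sqrt_nonneg _) (norm2_condExp_le μ _) 2
    _ ≤ (⟪x (traceVector Γ ι μ),
          fibreProjection μ Γ ι (deformation μ e b t x (traceVector Γ ι μ))⟫_ℂ).re :=
        norm_sq_le_re_inner_of_apply_eq_smul (fun _ => (Real.exp_pos _).le)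
          (fun _ => Real.exp_le_one_iff.2 (neg_nonpos.2 (sq_nonneg _)))
          (fibreProjection_deformation_traceVector μ e hb t hx)
    _ = (⟪x (traceVector Γ ι μ), deformation μ e b t x (traceVector Γ ι μ)⟫_ℂ).re := by
        rw [← inner_fibreProjection_left, fibreProjection_apply_traceVector μ hx]

end Estimate

end GaussianDeformation

end

theorem corollary3p4 {Γ ι H X : Type*} [Group Γ] [NormedAddCommGroup H] [InnerProductSpace ℝ H]
    [MeasurableSpace X] (μ : Measure X) [IsProbabilityMeasure μ]
    [MulAction Γ X] [MeasurableConstSMul Γ X] [SMulInvariantMeasure Γ X μ]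
    (e : HilbertBasis ι ℝ H) (π : Γ →* (H ≃ₗᵢ[ℝ] H)) (b : Γ → H)
    (hb : ∀ g h, b (g * h) = π g (b h) + b g)
    (Q : VonNeumannAlgebra (GaussianDeformation.Space Γ ι μ))
    (hQ : Q ≤ GaussianDeformation.smallAlgebra μ Γ ι)
    (δ t : ℝ) (hδ : 0 < δ)
    (h : ∀ x ∈ Q, x ∈ unitary (GaussianDeformation.Op Γ ι μ) →
      δ ≤ GaussianDeformation.norm2 (GaussianDeformation.condExp
        (GaussianDeformation.smallAlgebra μ Γ ι) (GaussianDeformation.deformation μ e b t x))) :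
    ∃ v ∈ GaussianDeformation.bigAlgebra μ e π, v ≠ 0 ∧ v * star v * v = v ∧
      ∀ x ∈ Q, GaussianDeformation.deformation μ e b t x * v = v * x := by
  open GaussianDeformation in
  have hb1 : b 1 = 0 := by simpa using hb 1 1
  have htr := isTraceVector_traceVector μ e π
  have hQN : Q ≤ bigAlgebra μ e π := hQ.trans (smallAlgebra_le_bigAlgebra μ e π)
  have hα : ∀ x ∈ Q, deformation μ e b t x ∈ bigAlgebra μ e π := fun x hx =>
    deformation_mem μ e π b hb t (hQN hx)
  obtain ⟨v, hvN, hv0, hv, hvQ⟩ := exists_partialIsometry_intertwiner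
    (isSeparatingVector_traceVector μ e π) htr hQN
    ((StarAlgEquiv.toStarAlgHom (deformation μ e b t)).comp Q.toStarSubalgebra.subtype)
    (fun x => hα x x.2) (pow_pos hδ 2) fun u => by
      have hu := (Unitary.map (.ofClass Q.toStarSubalgebra.subtype) u).2
      refine (pow_le_pow_left₀ hδ.le (h u u.1.2 hu) 2).trans ?_
      refine (norm2_condExp_deformation_sq_le μ e hb1 t (hQ u.1.2)).trans_eq ?_
      exact (htr.re_inner_mul_star_apply (hα u u.1.2) (hQN u.1.2)).symm
  exact ⟨v, hvN, hv0, hv, fun x hx => hvQ ⟨x, hx⟩⟩
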